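/- Let $q$ be a prime power, and let $W(q)$ be the symplectic generalized quadrangle: its points are all the points of the projective space $\mathrm{PG}(3,q)$, its lines are the lines of $\mathrm{PG}(3,q)$ that are self-conjugate with respect to a null polarity (that is, the two-dimensional subspaces $U$ of a four-dimensional vector space over $\mathbb{F}_q$ with $U^\perp=U$ for a nondegenerate alternating bilinear form), and incidence is inherited from $\mathrm{PG}(3,q)$. The metric dimension of a finite connected graph is the smallest size of a set $S$ of vertices such that any two distinct vertices $u,v$ satisfy $d(u,s)\neq d(v,s)$ for some $s\in S$. Let $\mu(W(q))$ be the metric dimension of the incidence graph of $W(q)$, the bipartite graph on the points and lines in which a point and a line are adjacent if and only if they are incident. Then \[\max\{6q-27,\,4q-7\}\le\mu(W(q))\le 8q,\] and if $q$ is odd then moreover $\mu(W(q))\le 8q-1$. -/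

import Mathlib

/-- `S` is a resolving set of the graph `G`: every vertex is determined by its distances
to the elements of `S`. (Used for connected graphs, where `G.dist` is the true distance.) -/
def SimpleGraph.IsResolvingSet {V : Type*} (G : SimpleGraph V) (S : Finset V) : Prop :=
  ∀ u v : V, (∀ s ∈ S, G.dist u s = G.dist v s) → u = v

/-- The metric dimension of a finite connected graph: the size of a smallest resolving set.
For a finite graph the set of sizes is nonempty, since the set of all vertices is resolving. -/
noncomputable def SimpleGraph.metricDimension {V : Type*} (G : SimpleGraph V) : ℕ :=
  sInf {n : ℕ | ∃ S : Finset V, G.IsResolvingSet S ∧ S.card = n}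

/-- The incidence graph of a point-line geometry with incidence relation `I`: the bipartite graph
on points and lines in which a point and a line are adjacent iff they are incident. -/
def incidenceGraph {P L : Type*} (I : P → L → Prop) : SimpleGraph (P ⊕ L) where
  Adj
    | .inl p, .inr l => I p l
    | .inr l, .inl p => I p l
    | .inl _, .inl _ => False
    | .inr _, .inr _ => False
  symm := ⟨by rintro (p | l) (p' | l') h <;> exact h⟩
  loopless := ⟨by rintro (p | l) h <;> exact h⟩

namespace SymplecticQuadrangle

variable {F V : Type*} [Field F] [AddCommGroup V] [Module F V]

/-- The lines of the symplectic quadrangle: the lines of the projective space of `V`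
(two-dimensional subspaces) which are self-conjugate under the polarity `U ↦ U^⊥` given by the
form `B`. For `V` of dimension 4 and `B` alternating and nondegenerate, this is a null polarity. -/
def Line (B : LinearMap.BilinForm F V) : Type _ :=
  {l : Submodule F V // Module.finrank F l = 2 ∧ B.orthogonal l = l}

/-- The incidence graph of the symplectic quadrangle: its points are all points of the projective
space of `V`, its lines are the self-conjugate lines, and incidence is containment. -/
def graph (B : LinearMap.BilinForm F V) : SimpleGraph (Projectivization F V ⊕ Line B) :=
  incidenceGraph fun (p : Projectivization F V) (l : Line B) => p.submodule ≤ l.1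

end SymplecticQuadrangle

/-! In the incidence graph of a generalized quadrangle, distances between elements of the same kind
are 0, 2 or 4, and distances between a point and a line are 1 or 3. A nonempty landmark set, with
points `A` and lines `C`, is therefore resolving exactly when it separates points from points and
lines from lines, using only equality, collinearity (or concurrency) and incidence.

Lower bound. By duality assume |A| ≤ |C|. A point outside `A` and off all lines of `C` is known only
through its trace, the set of points of `A` collinear with it, so these traces are distinct. Hence
at most C(|A|, k) of them have size k, while their total size is at most |A| q(q+1). Weighting each
free point by 2 or by 3 and correcting for the small traces bounds the number of points
(`two_mul_card_le`, `three_mul_card_le`), which yields 4q - 7 and 6q - 27.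

Upper bound. A point u corresponds, up to scalars, to the linear form B(u, ·), and collinearity with
s is vanishing at s. Take four lines of PG(3,q) without a common transversal, with one point removed
from each: the zeros of a form among these 4q points determine it up to a scalar
(`exists_separating_family`), so they resolve the points. For the lines there are two cases. In
characteristic 2 the quadrangle is self-dual: suitable Plücker coordinates turn lines into points of
PG(3,q) and concurrency into orthogonality, so the same family gives 4q lines. In odd characteristic
three pairwise disjoint lines have at most two common transversals (`false_of_three_transversals`).
The pencils at three points of a line m then separate the lines disjoint from m. The points of m
already in `A`, together with q - 1 lines through one more point, handle the rest, for a total of 4q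
- 1 lines. -/

/-- The axioms of a generalized quadrangle for an incidence relation `I`: every point lies on a
line and dually, and for every non-incident point-line pair `(p, l)` there is a unique
incident pair `(p', l')` with `p` on `l'` and `p'` on `l`. -/
structure IsGQ {P L : Type*} (I : P → L → Prop) : Prop where
  exists_line : ∀ p, ∃ l, I p l
  exists_point : ∀ l, ∃ p, I p l
  proj : ∀ p l, ¬ I p l → ∃ p' l', I p l' ∧ I p' l' ∧ I p' l
  proj_unique : ∀ p l, ¬ I p l → ∀ p₁ l₁ p₂ l₂, I p l₁ → I p₁ l₁ → I p₁ l → I p l₂ → I p₂ l₂ →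
    I p₂ l → p₁ = p₂ ∧ l₁ = l₂
  inter : ∀ p p' l l', I p l → I p' l → I p l' → I p' l' → p = p' ∨ l = l'

/-- Two points are collinear if some line contains both. -/
def Coll {P L : Type*} (I : P → L → Prop) (p p' : P) : Prop := ∃ l, I p l ∧ I p' l

/-- The points are resolved by the points in `A` and the lines in `C`. -/
def ResolvesPoints {P L : Type*} (I : P → L → Prop) (A : Finset P) (C : Finset L) : Prop :=
  ∀ u v : P, (∀ s ∈ A, (u = s ↔ v = s) ∧ (Coll I u s ↔ Coll I v s)) →
    (∀ l ∈ C, I u l ↔ I v l) → u = v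

/-! ### Distances in the incidence graph of a generalized quadrangle -/

section Abstract

variable {P L : Type*} {I : P → L → Prop}

namespace IsGQ

theorem dual (h : IsGQ I) : IsGQ (fun l p => I p l) where
  exists_line := h.exists_point
  exists_point := h.exists_line
  proj l p hp := by
    obtain ⟨p', l', h1, h2, h3⟩ := h.proj p l hp
    exact ⟨l', p', h3, h2, h1⟩
  proj_unique l p hp l₁ p₁ l₂ p₂ a b c d e f :=
    (h.proj_unique p l hp p₁ l₁ p₂ l₂ c b a f e d).symm
  inter l l' p p' a b c d := (h.inter p p' l l' a c b d).symm

end IsGQ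

open SimpleGraph

/-- The incidence graph is bipartite. -/
def incidenceColoring (I : P → L → Prop) : (incidenceGraph I).Coloring Bool :=
  Coloring.mk Sum.isLeft (by rintro (p | l) (p' | l') h <;> first | exact h.elim | simp)

/-- The incidence graphs of a geometry and its dual are isomorphic. -/
def incidenceGraphSwap (I : P → L → Prop) :
    incidenceGraph I ≃g incidenceGraph (fun l p => I p l) where
  toEquiv := Equiv.sumComm P L
  map_rel_iff' := by rintro (p | l) (p' | l') <;> exact Iff.rfl

theorem SimpleGraph.Hom.dist_le {V W : Type*} {G : SimpleGraph V} {H : SimpleGraph W}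
    (f : G →g H) {u v : V} (h : G.Reachable u v) : H.dist (f u) (f v) ≤ G.dist u v := by
  obtain ⟨w, hw⟩ := h.exists_walk_length_eq_dist
  rw [← hw, ← Walk.length_map f w]
  exact SimpleGraph.dist_le _

theorem SimpleGraph.Connected.dist_iso {V W : Type*} {G : SimpleGraph V} {H : SimpleGraph W}
    (hG : G.Connected) (f : G ≃g H) (u v : V) : H.dist (f u) (f v) = G.dist u v := by
  refine le_antisymm (Hom.dist_le f.toHom (hG u v)) ?_
  have hH : H.Connected := f.connected_iff.mp hG
  simpa using Hom.dist_le f.symm.toHom (hH (f u) (f v))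

theorem incidenceGraph_adj {p : P} {l : L} (h : I p l) :
    (incidenceGraph I).Adj (.inl p) (.inr l) := h

namespace IsGQ

theorem exists_walk_inl_inr (h : IsGQ I) (p : P) (l : L) :
    ∃ w : (incidenceGraph I).Walk (.inl p) (.inr l), w.length ≤ 3 ∧ (I p l → w.length = 1) := by
  by_cases hp : I p l
  · exact ⟨.cons (incidenceGraph_adj hp) .nil, by simp, by simp⟩
  · obtain ⟨p', l', h1, h2, h3⟩ := h.proj p l hp
    exact ⟨.cons (incidenceGraph_adj h1) (.cons (incidenceGraph_adj h2).symm
      (.cons (incidenceGraph_adj h3) .nil)),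
      by simp, fun h => (hp h).elim⟩

theorem exists_walk_inl_inl (h : IsGQ I) (p p' : P) :
    ∃ w : (incidenceGraph I).Walk (.inl p) (.inl p'),
      w.length ≤ 4 ∧ (Coll I p p' → w.length = 2) := by
  by_cases hp : Coll I p p'
  · obtain ⟨l, h1, h2⟩ := hp
    exact ⟨.cons (incidenceGraph_adj h1) (.cons (incidenceGraph_adj h2).symm .nil), by simp, by simp⟩
  · obtain ⟨l, hl⟩ := h.exists_line p'
    obtain ⟨w, hw, -⟩ := h.exists_walk_inl_inr p l
    refine ⟨w.append (.cons (incidenceGraph_adj hl).symm .nil), ?_, fun h => (hp h).elim⟩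
    simp
    omega

theorem connected [Nonempty P] (h : IsGQ I) : (incidenceGraph I).Connected := by
  obtain ⟨p⟩ := ‹Nonempty P›
  rw [connected_iff_exists_forall_reachable]
  refine ⟨.inl p, ?_⟩
  rintro (p' | l)
  · exact ⟨(h.exists_walk_inl_inl p p').choose⟩
  · exact ⟨(h.exists_walk_inl_inr p l).choose⟩

open Classical in
theorem dist_inl_inl [Nonempty P] (h : IsGQ I) (p p' : P) :
    (incidenceGraph I).dist (.inl p) (.inl p') =
      if p = p' then 0 else if Coll I p p' then 2 else 4 := by
  have hc := h.connected
  obtain ⟨w, hw⟩ := hc.exists_walk_length_eq_dist (.inl p) (.inl p')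
  have hev : Even w.length := ((incidenceColoring I).even_length_iff_congr w).mpr Iff.rfl
  obtain ⟨w', hw4, hw2⟩ := h.exists_walk_inl_inl p p'
  have hle := (incidenceGraph I).dist_le w'
  split_ifs with h1 h2
  · subst h1; simp
  · have := hw2 h2
    have h0 : (incidenceGraph I).dist (.inl p) (.inl p') ≠ 0 := by
      rw [Ne, hc.dist_eq_zero_iff]; simpa using h1
    obtain ⟨k, hk⟩ := hev
    omega
  · have h0 : (incidenceGraph I).dist (.inl p) (.inl p') ≠ 0 := by
      rw [Ne, hc.dist_eq_zero_iff]; simpa using h1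
    have h3 : w.length ≠ 2 := by
      intro h3
      clear hw hev
      match w, h3 with
      | .cons (v := .inr l) a (.cons b .nil), _ => exact h2 ⟨l, a, b⟩
      | .cons (v := .inl l) a _, _ => exact a
    obtain ⟨k, hk⟩ := hev
    omega

open Classical in
theorem dist_inl_inr [Nonempty P] (h : IsGQ I) (p : P) (l : L) :
    (incidenceGraph I).dist (.inl p) (.inr l) = if I p l then 1 else 3 := by
  have hc := h.connected
  obtain ⟨w, hw⟩ := hc.exists_walk_length_eq_dist (.inl p) (.inr l)
  have hev : Odd w.length := ((incidenceColoring I).odd_length_iff_not_congr w).mpr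
    (by change (¬ true = true ↔ false = true); simp)
  obtain ⟨w', hw4, hw2⟩ := h.exists_walk_inl_inr p l
  have hle := (incidenceGraph I).dist_le w'
  obtain ⟨k, hk⟩ := hev
  split_ifs with h1
  · have := hw2 h1
    omega
  · have h0 : (incidenceGraph I).dist (.inl p) (.inr l) ≠ 1 := by
      rw [Ne, dist_eq_one_iff_adj]; exact h1
    omega

open Classical in
theorem dist_inr_inl [Nonempty P] (h : IsGQ I) (p : P) (l : L) :
    (incidenceGraph I).dist (.inr l) (.inl p) = if I p l then 1 else 3 := by
  rw [dist_comm, h.dist_inl_inr]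

open Classical in
theorem dist_inr_inr [Nonempty P] (h : IsGQ I) (l l' : L) :
    (incidenceGraph I).dist (.inr l) (.inr l') =
      if l = l' then 0 else if Coll (fun l p => I p l) l l' then 2 else 4 := by
  have : Nonempty L := ⟨l⟩
  rw [← h.dual.dist_inl_inl, ← h.connected.dist_iso (incidenceGraphSwap I)]
  rfl

theorem dist_inl_inl_eq_iff [Nonempty P] (h : IsGQ I) (u v s : P) :
    (incidenceGraph I).dist (.inl u) (.inl s) = (incidenceGraph I).dist (.inl v) (.inl s) ↔
      (u = s ↔ v = s) ∧ (Coll I u s ↔ Coll I v s) := by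
  -- Self-collinearity excludes the combination u = s with u not collinear with s, so the two
  -- conditions encode exactly the three distances 0, 2, 4.
  have hs : Coll I s s := (h.exists_line s).imp fun _ hl => ⟨hl, hl⟩
  rw [h.dist_inl_inl, h.dist_inl_inl]
  split_ifs with h1 h2 h2 <;> simp_all

theorem dist_inl_inr_eq_iff [Nonempty P] (h : IsGQ I) (u v : P) (l : L) :
    (incidenceGraph I).dist (.inl u) (.inr l) = (incidenceGraph I).dist (.inl v) (.inr l) ↔
      (I u l ↔ I v l) := by
  rw [h.dist_inl_inr, h.dist_inl_inr]
  split_ifs <;> simp_all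

theorem dist_inr_inr_eq_iff [Nonempty P] (h : IsGQ I) (u v s : L) :
    (incidenceGraph I).dist (.inr u) (.inr s) = (incidenceGraph I).dist (.inr v) (.inr s) ↔
      (u = s ↔ v = s) ∧ (Coll (fun l p => I p l) u s ↔ Coll (fun l p => I p l) v s) := by
  have hs : Coll (fun l p => I p l) s s := (h.exists_point s).imp fun _ hl => ⟨hl, hl⟩
  rw [h.dist_inr_inr, h.dist_inr_inr]
  split_ifs with h1 h2 h2 <;> simp_all

/-- By parity, any single landmark tells points from lines; hence only nonemptiness is needed to
combine the two separation conditions. -/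
theorem dist_inl_ne_dist_inr [Nonempty P] (h : IsGQ I) (u : P) (v : L) (s : P ⊕ L) :
    (incidenceGraph I).dist (.inl u) s ≠ (incidenceGraph I).dist (.inr v) s := by
  rcases s with s | s
  · rw [h.dist_inl_inl, h.dist_inr_inl]
    split_ifs <;> simp
  · rw [h.dist_inr_inr, h.dist_inl_inr]
    split_ifs <;> simp

theorem resolvesPoints_of_isResolvingSet [Nonempty P] (h : IsGQ I) {S : Finset (P ⊕ L)}
    (hS : (incidenceGraph I).IsResolvingSet S) : ResolvesPoints I S.toLeft S.toRight := by
  intro u v h1 h2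
  refine Sum.inl_injective (hS (.inl u) (.inl v) ?_)
  rintro (s | s) hs
  · exact (h.dist_inl_inl_eq_iff u v s).mpr (h1 s (by simpa using hs))
  · exact (h.dist_inl_inr_eq_iff u v s).mpr (h2 s (by simpa using hs))

theorem resolvesLines_of_isResolvingSet [Nonempty P] (h : IsGQ I) {S : Finset (P ⊕ L)}
    (hS : (incidenceGraph I).IsResolvingSet S) :
    ResolvesPoints (fun l p => I p l) S.toRight S.toLeft := by
  intro u v h1 h2
  refine Sum.inr_injective (hS (.inr u) (.inr v) ?_)
  rintro (s | s) hs
  · rw [h.dist_inr_inl, h.dist_inr_inl]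
    have : I s u ↔ I s v := h2 s (by simpa using hs)
    by_cases hv : I s v <;> simp [this, hv]
  · exact (h.dist_inr_inr_eq_iff u v s).mpr (h1 s (by simpa using hs))

theorem isResolvingSet_disjSum [Nonempty P] (h : IsGQ I) {A : Finset P} {C : Finset L}
    (hA : A.Nonempty) (h1 : ResolvesPoints I A C)
    (h2 : ResolvesPoints (fun l p => I p l) C A) :
    (incidenceGraph I).IsResolvingSet (A.disjSum C) := by
  obtain ⟨a, ha⟩ := hA
  rintro (u | u) (v | v) huv
  · refine congrArg _ (h1 u v ?_ ?_)
    · exact fun s hs => (h.dist_inl_inl_eq_iff u v s).mp (huv _ (by simpa using hs))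
    · exact fun s hs => (h.dist_inl_inr_eq_iff u v s).mp (huv _ (by simpa using hs))
  · exact (h.dist_inl_ne_dist_inr u v _ (huv (.inl a) (by simpa using ha))).elim
  · exact (h.dist_inl_ne_dist_inr v u _ (huv (.inl a) (by simpa using ha)).symm).elim
  · refine congrArg _ (h2 u v ?_ ?_)
    · exact fun s hs => (h.dist_inr_inr_eq_iff u v s).mp (huv _ (by simpa using hs))
    · intro s hs
      have := huv (.inl s) (by simpa using hs)
      rw [h.dist_inr_inl, h.dist_inr_inl] at this
      split_ifs at this <;> simp_all

end IsGQ

end Abstract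

/-! ### Counting traces: the lower bounds -/

section LowerBound

open Finset Classical

variable {P L : Type*} {I : P → L → Prop} [Fintype P] [Fintype L]

/-- A point of a geometry with at most `q + 1` lines on each point and at most `q + 1` points on
each line is collinear with at most `(q + 1) * q` other points. -/
theorem card_coll_le {q : ℕ} (hl : ∀ l, #{p | I p l} ≤ q + 1) (hp : ∀ p, #{l | I p l} ≤ q + 1)
    (s : P) : #{u | u ≠ s ∧ Coll I u s} ≤ (q + 1) * q := by
  have hsub : (univ.filter fun u => u ≠ s ∧ Coll I u s) ⊆
      (univ.filter fun l => I s l).biUnion fun l => (univ.filter fun p => I p l).erase s := by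
    rintro u hu
    obtain ⟨h1, l, h2, h3⟩ := (mem_filter.mp hu).2
    simp only [mem_biUnion, mem_filter, mem_univ, true_and, mem_erase]
    exact ⟨l, h3, h1, h2⟩
  refine (card_le_card hsub).trans ((card_biUnion_le_card_mul _ _ q ?_).trans ?_)
  · intro l h
    rw [card_erase_of_mem (by simpa using h)]
    have := hl l
    omega
  · exact Nat.mul_le_mul_right _ (hp s)

/-- The points outside `A` and not on a line of `C`. -/
noncomputable def freePoints (I : P → L → Prop) (A : Finset P) (C : Finset L) : Finset P :=
  {u | u ∉ A ∧ ∀ l ∈ C, ¬ I u l}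

/-- The points of `A` collinear with `u`. -/
noncomputable def trace (I : P → L → Prop) (A : Finset P) (u : P) : Finset P :=
  {s ∈ A | Coll I u s}

theorem card_le_freePoints {q : ℕ} (hl : ∀ l, #{p | I p l} ≤ q + 1)
    (A : Finset P) (C : Finset L) :
    Fintype.card P ≤ #(freePoints I A C) + #A + #C * (q + 1) := by
  have hsub : (univ : Finset P) ⊆ freePoints I A C ∪ A ∪
      C.biUnion fun l => (univ.filter fun p => I p l) := by
    intro u _
    simp only [freePoints, mem_union, mem_biUnion, mem_filter, mem_univ, true_and]
    by_contra! h
    obtain ⟨⟨h1, h2⟩, h3⟩ := h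
    obtain ⟨l, hl, hl'⟩ := h1 h2
    exact h3 l hl hl'
  refine (card_le_card hsub).trans ((card_union_le _ _).trans ?_)
  gcongr
  · exact card_union_le _ _
  · exact card_biUnion_le_card_mul _ _ _ fun l _ => hl l

/-- A free point has distance 3 to every line of `C` and distance 2 or 4 to every point of `A`, so
its trace carries all the available information. -/
theorem trace_injOn {A : Finset P} {C : Finset L} (h : ResolvesPoints I A C) :
    Set.InjOn (trace I A) (freePoints I A C : Set P) := by
  intro u hu v hv huv
  simp only [freePoints, mem_coe, mem_filter, mem_univ, true_and] at hu hv
  refine h u v (fun s hs => ⟨?_, ?_⟩) fun l hl => ?_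
  · exact ⟨fun h => (hu.1 (h ▸ hs)).elim, fun h => (hv.1 (h ▸ hs)).elim⟩
  · have := Finset.ext_iff.mp huv s
    simpa [trace, hs] using this
  · exact iff_of_false (hu.2 l hl) (hv.2 l hl)

theorem card_trace_eq_le {A : Finset P} {C : Finset L} (h : ResolvesPoints I A C) (k : ℕ) :
    #{u ∈ freePoints I A C | #(trace I A u) = k} ≤ (#A).choose k := by
  rw [← card_powersetCard]
  refine card_le_card_of_injOn (trace I A) ?_ ((trace_injOn h).mono (coe_subset.mpr (filter_subset _ _)))
  intro u hu
  rw [mem_coe, mem_filter] at hu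
  rw [mem_coe, mem_powersetCard]
  exact ⟨filter_subset _ _, hu.2⟩

theorem sum_card_trace_le {q : ℕ} (hl : ∀ l, #{p | I p l} ≤ q + 1)
    (hp : ∀ p, #{l | I p l} ≤ q + 1) (A : Finset P) (C : Finset L) :
    ∑ u ∈ freePoints I A C, #(trace I A u) ≤ #A * ((q + 1) * q) := by
  have : ∑ u ∈ freePoints I A C, #(trace I A u) =
      ∑ s ∈ A, #{u ∈ freePoints I A C | Coll I u s} :=
    sum_card_bipartiteAbove_eq_sum_card_bipartiteBelow (Coll I)
  rw [this, ← smul_eq_mul]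
  refine sum_le_card_nsmul _ _ _ fun s hs => (card_le_card ?_).trans (card_coll_le hl hp s)
  intro u hu
  simp only [freePoints, mem_filter, mem_univ, true_and] at hu ⊢
  exact ⟨fun h => hu.1.1 (h ▸ hs), hu.2⟩

/-- Each free point is charged 2: its trace size pays, with a deficit of 2 for the empty trace (at
most one point) and of 1 for singleton traces (at most |A| points). The remaining 2|A| and 2|C|(q+1)
account for the points that are not free. -/
theorem two_mul_card_le {q : ℕ} (hl : ∀ l, #{p | I p l} ≤ q + 1)
    (hp : ∀ p, #{l | I p l} ≤ q + 1) {A : Finset P} {C : Finset L} (h : ResolvesPoints I A C) :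
    2 * Fintype.card P ≤ #A * ((q + 1) * q) + 2 + 3 * #A + 2 * (#C * (q + 1)) := by
  have h1 := card_le_freePoints hl A C
  have h2 := sum_card_trace_le hl hp A C
  have h3 : ∑ u ∈ freePoints I A C, 2 ≤ ∑ u ∈ freePoints I A C, (#(trace I A u) +
      (if #(trace I A u) = 0 then 2 else 0) + (if #(trace I A u) = 1 then 1 else 0)) :=
    sum_le_sum fun u _ => by split_ifs <;> omega
  have h4 := card_trace_eq_le h 0
  have h5 := card_trace_eq_le h 1
  simp only [sum_add_distrib, ← sum_filter, sum_const, smul_eq_mul] at h3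
  simp only [Nat.choose_zero_right, Nat.choose_one_right] at h4 h5
  omega

/-- The same count with charge 3, where traces of size 0, 1, 2 leave deficits 3, 2, 1. -/
theorem three_mul_card_le {q : ℕ} (hl : ∀ l, #{p | I p l} ≤ q + 1)
    (hp : ∀ p, #{l | I p l} ≤ q + 1) {A : Finset P} {C : Finset L} (h : ResolvesPoints I A C) :
    3 * Fintype.card P ≤
      #A * ((q + 1) * q) + 3 + 5 * #A + (#A).choose 2 + 3 * (#C * (q + 1)) := by
  have h1 := card_le_freePoints hl A C
  have h2 := sum_card_trace_le hl hp A C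
  have h3 : ∑ u ∈ freePoints I A C, 3 ≤ ∑ u ∈ freePoints I A C, (#(trace I A u) +
      (if #(trace I A u) = 0 then 3 else 0) + (if #(trace I A u) = 1 then 2 else 0) +
      (if #(trace I A u) = 2 then 1 else 0)) :=
    sum_le_sum fun u _ => by split_ifs <;> omega
  have h4 := card_trace_eq_le h 0
  have h5 := card_trace_eq_le h 1
  have h6 := card_trace_eq_le h 2
  simp only [sum_add_distrib, ← sum_filter, sum_const, smul_eq_mul] at h3
  simp only [Nat.choose_zero_right, Nat.choose_one_right] at h4 h5
  omega

theorem four_mul_le_of_card_le {q : ℕ}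
    (hP : Fintype.card P = (q + 1) * (q ^ 2 + 1)) (hl : ∀ l, #{p | I p l} ≤ q + 1)
    (hp : ∀ p, #{l | I p l} ≤ q + 1) {A : Finset P} {C : Finset L} (h : ResolvesPoints I A C)
    (hAC : #A ≤ #C) : 4 * q ≤ #A + #C + 7 := by
  have h1 := two_mul_card_le hl hp h
  rw [hP] at h1
  generalize #A = a at *
  generalize #C = b at *
  by_contra! h2
  zify at *
  -- After eliminating |C| through a + b ≤ 4q - 8, the coefficient of a is q² - q + 1, and |A| ≤ |C|
  -- gives a ≤ 2q - 4.
  nlinarith [mul_nonneg (by linarith : (0 : ℤ) ≤ 2 * q - 4 - a) (by nlinarith : (0 : ℤ) ≤ q ^ 2 - q + 1),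
    mul_nonneg (by linarith : (0 : ℤ) ≤ 4 * q - 8 - a - b) (by linarith : (0 : ℤ) ≤ 2 * (q + 1))]

theorem six_mul_le_of_card_le {q : ℕ}
    (hP : Fintype.card P = (q + 1) * (q ^ 2 + 1)) (hl : ∀ l, #{p | I p l} ≤ q + 1)
    (hp : ∀ p, #{l | I p l} ≤ q + 1) {A : Finset P} {C : Finset L} (h : ResolvesPoints I A C)
    (hAC : #A ≤ #C) : 6 * q ≤ #A + #C + 27 := by
  have h1 := three_mul_card_le hl hp h
  rw [hP] at h1
  have h3 : 2 * (#A).choose 2 ≤ #A * #A := by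
    rw [Nat.choose_two_right]
    exact (Nat.mul_div_le _ _).trans (Nat.mul_le_mul_left _ (Nat.sub_le _ _))
  generalize (#A).choose 2 = c at *
  generalize #A = a at *
  generalize #C = b at *
  by_contra! h2
  zify at *
  have ha : (a : ℤ) ≤ 3 * q - 14 := by linarith
  have h4 : (b : ℤ) * (q + 1) ≤ (6 * q - 28 - a) * (q + 1) :=
    mul_le_mul_of_nonneg_right (by linarith) (by linarith)
  have h5 : (a : ℤ) * a ≤ a * (3 * q - 14) := mul_le_mul_of_nonneg_left ha (by linarith)
  have h6 : (0 : ℤ) ≤ (3 * q - 14 - a) * (2 * q ^ 2 - q) :=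
    mul_nonneg (by linarith) (by nlinarith)
  nlinarith

/-- Lower bounds for resolving sets of a generalized quadrangle of order `(q, q)`. -/
theorem IsGQ.le_card_of_isResolvingSet (hI : IsGQ I) {q : ℕ}
    (hP : Fintype.card P = (q + 1) * (q ^ 2 + 1)) (hL : Fintype.card L = (q + 1) * (q ^ 2 + 1))
    (hl : ∀ l, #{p | I p l} ≤ q + 1) (hp : ∀ p, #{l | I p l} ≤ q + 1) {S : Finset (P ⊕ L)}
    (hS : (incidenceGraph I).IsResolvingSet S) : 6 * q ≤ #S + 27 ∧ 4 * q ≤ #S + 7 := by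
  have : Nonempty P := Fintype.card_pos_iff.mp (by rw [hP]; positivity)
  have h1 := hI.resolvesPoints_of_isResolvingSet hS
  have h2 := hI.resolvesLines_of_isResolvingSet hS
  have h3 : #S = #S.toLeft + #S.toRight := S.card_toLeft_add_card_toRight.symm
  rcases le_total #S.toLeft #S.toRight with h | h
  · have a := six_mul_le_of_card_le hP hl hp h1 h
    have b := four_mul_le_of_card_le hP hl hp h1 h
    omega
  · have a := six_mul_le_of_card_le hL hp hl h2 h
    have b := four_mul_le_of_card_le hL hp hl h2 h
    omega

theorem IsGQ.card_coll_eq (hI : IsGQ I) {q : ℕ} (hl : ∀ l, #{p | I p l} = q + 1) (s : P) :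
    #{u | u ≠ s ∧ Coll I u s} = #{l | I s l} * q := by
  have heq : (univ.filter fun u => u ≠ s ∧ Coll I u s) =
      (univ.filter fun l => I s l).biUnion fun l => (univ.filter fun p => I p l).erase s := by
    ext u
    simp only [mem_biUnion, mem_filter, mem_univ, true_and, mem_erase]
    constructor
    · rintro ⟨h1, l, h2, h3⟩
      exact ⟨l, h3, h1, h2⟩
    · rintro ⟨l, h3, h1, h2⟩
      exact ⟨h1, l, h2, h3⟩
  rw [heq, card_biUnion, ← smul_eq_mul, ← sum_const]
  · refine sum_congr rfl fun l h => ?_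
    rw [card_erase_of_mem (by simpa using h), hl l, Nat.add_sub_cancel]
  · intro l h l' h' hne
    rw [Function.onFun, Finset.disjoint_left]
    intro x hx hx'
    simp only [mem_coe, mem_filter, mem_univ, true_and, mem_erase] at h h' hx hx'
    exact (hI.inter x s l l' hx.2 h hx'.2 h').elim hx.1 hne

theorem card_lines_eq {q : ℕ} (hl : ∀ l, #{p | I p l} = q + 1) (hp : ∀ p, #{l | I p l} = q + 1) :
    Fintype.card L = Fintype.card P := by
  have h := sum_card_bipartiteAbove_eq_sum_card_bipartiteBelow I (s := univ) (t := univ)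
  simp only [bipartiteAbove, bipartiteBelow, hl, hp, sum_const, smul_eq_mul, card_univ] at h
  exact (Nat.eq_of_mul_eq_mul_right (Nat.succ_pos q) h).symm

end LowerBound

/-! ### W(q) as a generalized quadrangle of order (q, q) -/

namespace SymplecticQuadrangle

open Projectivization Module

variable {F V : Type*} [Field F] [AddCommGroup V] [Module F V] {B : LinearMap.BilinForm F V}

/-- The defining properties of a symplectic form on a four-dimensional space. -/
structure IsSymplectic (B : LinearMap.BilinForm F V) : Prop where
  finrank_eq : finrank F V = 4
  alt : B.IsAlt
  nondeg : B.Nondegenerate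

/-- Incidence of the symplectic quadrangle. -/
def Inc (B : LinearMap.BilinForm F V) (p : Projectivization F V) (l : Line B) : Prop :=
  p.submodule ≤ l.1

theorem inc_iff {p : Projectivization F V} {l : Line B} : Inc B p l ↔ p.rep ∈ l.1 := by
  rw [Inc, submodule_eq, Submodule.span_singleton_le_iff_mem]

theorem inc_mk {v : V} {hv : v ≠ 0} {l : Line B} :
    Inc B (Projectivization.mk F v hv) l ↔ v ∈ l.1 := by
  rw [Inc, submodule_mk, Submodule.span_singleton_le_iff_mem]

theorem linearIndependent_rep {p p' : Projectivization F V} (h : p ≠ p') :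
    LinearIndependent F ![p.rep, p'.rep] :=
  linearIndependent_pair_iff_ne.mpr h

theorem finrank_span_pair {u v : V} (h : LinearIndependent F ![u, v]) :
    finrank F (Submodule.span F {u, v}) = 2 := by
  have := finrank_span_eq_card h
  rwa [Matrix.range_cons_cons_empty, Fintype.card_fin] at this

namespace Line

theorem apply_eq_zero (l : Line B) {x y : V} (hx : x ∈ l.1) (hy : y ∈ l.1) : B x y = 0 := by
  rw [← l.2.2] at hy
  exact hy x hx

theorem mem_of_forall (l : Line B) {y : V} (h : ∀ x ∈ l.1, B x y = 0) : y ∈ l.1 := by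
  rw [← l.2.2]
  exact h

theorem eq_span (l : Line B) {u v : V} (h : LinearIndependent F ![u, v]) (hu : u ∈ l.1)
    (hv : v ∈ l.1) : l.1 = Submodule.span F {u, v} := by
  have : FiniteDimensional F l.1 := Module.finite_of_finrank_pos (by rw [l.2.1]; simp)
  refine (Submodule.eq_of_le_of_finrank_eq ?_ ?_).symm
  · rw [Submodule.span_le]
    rintro x (rfl | rfl) <;> assumption
  · rw [l.2.1, finrank_span_pair h]

theorem exists_eq_span (l : Line B) :
    ∃ u v : V, LinearIndependent F ![u, v] ∧ l.1 = Submodule.span F {u, v} := by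
  have : FiniteDimensional F l.1 := Module.finite_of_finrank_pos (by rw [l.2.1]; simp)
  let b := finBasisOfFinrankEq F l.1 l.2.1
  have hb : LinearIndependent F ![(b 0 : V), (b 1 : V)] := by
    have := b.linearIndependent.map' l.1.subtype (Submodule.ker_subtype _)
    have heq : ![(b 0 : V), (b 1 : V)] = l.1.subtype ∘ b := by
      ext i
      fin_cases i <;> rfl
    rw [heq]
    exact this
  exact ⟨b 0, b 1, hb, l.eq_span hb (b 0).2 (b 1).2⟩

end Line

namespace IsSymplectic

theorem finiteDimensional (hB : IsSymplectic B) : FiniteDimensional F V :=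
  Module.finite_of_finrank_pos (by rw [hB.finrank_eq]; simp)

theorem apply_comm (hB : IsSymplectic B) (x y : V) : B y x = - B x y :=
  (LinearMap.IsAlt.neg hB.alt x y).symm

theorem apply_eq_zero_comm (hB : IsSymplectic B) {x y : V} : B x y = 0 ↔ B y x = 0 :=
  LinearMap.BilinForm.IsAlt.eq_iff hB.alt

theorem exists_line_of_apply_eq_zero (hB : IsSymplectic B) {u v : V}
    (h : LinearIndependent F ![u, v]) (huv : B u v = 0) :
    ∃ l : Line B, l.1 = Submodule.span F {u, v} := by
  have := hB.finiteDimensional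
  have h2 := finrank_span_pair h
  have hle : Submodule.span F {u, v} ≤ B.orthogonal (Submodule.span F {u, v}) := by
    intro y hy x hx
    obtain ⟨a, b, rfl⟩ := Submodule.mem_span_pair.mp hx
    obtain ⟨c, d, rfl⟩ := Submodule.mem_span_pair.mp hy
    simp [hB.alt.self_eq_zero, huv, hB.apply_eq_zero_comm.mp huv]
  refine ⟨⟨Submodule.span F {u, v}, h2, (Submodule.eq_of_le_of_finrank_eq hle ?_).symm⟩, rfl⟩
  rw [LinearMap.BilinForm.finrank_orthogonal hB.nondeg, h2, hB.finrank_eq]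

theorem finrank_ker_apply (hB : IsSymplectic B) {u : V} (hu : u ≠ 0) :
    finrank F (LinearMap.ker (B u)) = 3 := by
  have := hB.finiteDimensional
  have h1 : B.orthogonal (F ∙ u) = LinearMap.ker (B u) := by
    ext y
    rw [LinearMap.BilinForm.mem_orthogonal_iff, LinearMap.mem_ker]
    refine ⟨fun h => h u (Submodule.mem_span_singleton_self u), fun h x hx => ?_⟩
    obtain ⟨a, rfl⟩ := Submodule.mem_span_singleton.mp hx
    simp [h]
  rw [← h1, LinearMap.BilinForm.finrank_orthogonal hB.nondeg, finrank_span_singleton hu,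
    hB.finrank_eq]

theorem exists_linearIndependent_apply_eq_zero (hB : IsSymplectic B) {u : V} (hu : u ≠ 0) :
    ∃ v, LinearIndependent F ![u, v] ∧ B u v = 0 := by
  have := hB.finiteDimensional
  have h : ¬ LinearMap.ker (B u) ≤ F ∙ u := fun h => by
    have := Submodule.finrank_mono h
    rw [hB.finrank_ker_apply hu, finrank_span_singleton hu] at this
    omega
  obtain ⟨v, hv, hvu⟩ := SetLike.not_le_iff_exists.mp h
  refine ⟨v, ?_, hv⟩
  rw [LinearIndependent.pair_iff' hu]
  exact fun a ha => hvu (Submodule.mem_span_singleton.mpr ⟨a, ha⟩)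

theorem coll_iff (hB : IsSymplectic B) {p p' : Projectivization F V} :
    Coll (Inc B) p p' ↔ B p.rep p'.rep = 0 := by
  constructor
  · rintro ⟨l, h1, h2⟩
    exact l.apply_eq_zero (inc_iff.mp h1) (inc_iff.mp h2)
  · intro h
    by_cases hp : p = p'
    · subst hp
      obtain ⟨v, hv, h0⟩ := hB.exists_linearIndependent_apply_eq_zero p.rep_nonzero
      obtain ⟨l, hl⟩ := hB.exists_line_of_apply_eq_zero hv h0
      have : Inc B p l := by
        rw [inc_iff, hl]; exact Submodule.subset_span (by simp)
      exact ⟨l, this, this⟩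
    · obtain ⟨l, hl⟩ := hB.exists_line_of_apply_eq_zero (linearIndependent_rep hp) h
      refine ⟨l, ?_, ?_⟩ <;> rw [inc_iff, hl] <;> exact Submodule.subset_span (by simp)

/-- The symplectic quadrangle is a generalized quadrangle. -/
theorem isGQ (hB : IsSymplectic B) : IsGQ (Inc B) := by
  have inter : ∀ p p' l l', Inc B p l → Inc B p' l → Inc B p l' → Inc B p' l' →
      p = p' ∨ l = l' := by
    intro p p' l l' h1 h2 h3 h4
    rw [inc_iff] at *
    by_cases hp : p = p'
    · exact .inl hp
    · have h := linearIndependent_rep hp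
      exact .inr (Subtype.ext ((l.eq_span h h1 h2).trans (l'.eq_span h h3 h4).symm))
  refine ⟨?_, ?_, ?_, ?_, inter⟩
  · intro p
    obtain ⟨l, hl, -⟩ := hB.coll_iff.mpr (hB.alt.self_eq_zero p.rep)
    exact ⟨l, hl⟩
  · intro l
    obtain ⟨u, v, h, hl⟩ := l.exists_eq_span
    have hu : u ≠ 0 := h.ne_zero 0
    refine ⟨Projectivization.mk F u hu, ?_⟩
    rw [inc_mk, hl]
    exact Submodule.subset_span (by simp)
  · intro p l hp
    obtain ⟨u, v, h, hl⟩ := l.exists_eq_span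
    rw [inc_iff] at hp
    have hu : u ∈ l.1 := by rw [hl]; exact Submodule.subset_span (by simp)
    have hv : v ∈ l.1 := by rw [hl]; exact Submodule.subset_span (by simp)
    -- This vector spans the intersection of l with the plane p^⊥. If it vanished, p would be
    -- orthogonal to all of l, hence lie in l^⊥ = l.
    have hz : B p.rep u • v + (-B p.rep v) • u ≠ 0 := by
      intro h0
      rw [add_comm] at h0
      obtain ⟨h1, h2⟩ := LinearIndependent.pair_iff.mp h _ _ h0
      refine hp (l.mem_of_forall fun x hx => ?_)
      rw [hl] at hx
      obtain ⟨a, b, rfl⟩ := Submodule.mem_span_pair.mp hx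
      rw [hB.apply_eq_zero_comm]
      simp [h2, neg_eq_zero.mp h1]
    set z := B p.rep u • v + (-B p.rep v) • u with hzdef
    have hzl : z ∈ l.1 := l.1.add_mem (l.1.smul_mem _ hv) (l.1.smul_mem _ hu)
    have hpz : B p.rep z = 0 := by simp [hzdef]; ring
    have hpz' : B p.rep (Projectivization.mk F z hz).rep = 0 := by
      obtain ⟨a, ha⟩ := exists_smul_eq_mk_rep F z hz
      rw [← ha, Units.smul_def, map_smul, hpz, smul_zero]
    obtain ⟨l', h1, h2⟩ := hB.coll_iff.mpr hpz'
    exact ⟨_, l', h1, h2, inc_mk.mpr hzl⟩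
  · intro p l hp p₁ l₁ p₂ l₂ h1 h2 h3 h4 h5 h6
    -- Two distinct points of l orthogonal to p would span l and again put p in l^⊥ = l.
    have hpp : p₁ = p₂ := by
      by_contra hne
      rw [inc_iff] at *
      have hl := l.eq_span (linearIndependent_rep hne) h3 h6
      refine hp (l.mem_of_forall fun x hx => ?_)
      rw [hl] at hx
      obtain ⟨a, b, rfl⟩ := Submodule.mem_span_pair.mp hx
      simp [l₁.apply_eq_zero h2 h1, l₂.apply_eq_zero h5 h4]
    refine ⟨hpp, (inter p p₁ l₁ l₂ h1 h2 h4 (hpp ▸ h5)).resolve_left ?_⟩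
    rintro rfl
    exact hp h3

theorem finite_points [Finite F] (hB : IsSymplectic B) : Finite (Projectivization F V) := by
  have := hB.finiteDimensional
  have : Finite V := Module.finite_of_finite F
  infer_instance

theorem finite_lines [Finite F] (hB : IsSymplectic B) : Finite (Line B) := by
  have := hB.finiteDimensional
  have : Finite V := Module.finite_of_finite F
  exact Subtype.finite

end IsSymplectic

theorem card_points_mem (W : Submodule F V) :
    Nat.card {p : Projectivization F V // p.rep ∈ W} = Nat.card (Projectivization F W) := by
  symm
  refine Nat.card_congr (Equiv.ofBijective
    (fun x => ⟨x.map W.subtype W.injective_subtype, ?_⟩) ⟨?_, ?_⟩)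
  · induction x using Projectivization.ind with
    | h v hv =>
      rw [map_mk]
      obtain ⟨a, ha⟩ := exists_smul_eq_mk_rep F (W.subtype v) (by simpa using hv)
      rw [← ha]
      exact W.smul_mem _ v.2
  · intro x y hxy
    exact map_injective _ W.injective_subtype (congrArg Subtype.val hxy)
  · rintro ⟨p, hp⟩
    refine ⟨Projectivization.mk F ⟨p.rep, hp⟩ (by simpa using p.rep_nonzero), Subtype.ext ?_⟩
    simp only [map_mk]
    exact mk_rep p

namespace IsSymplectic

open Finset Classical

variable [Finite F] [Fintype (Projectivization F V)]

theorem card_points (hB : IsSymplectic B) :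
    Fintype.card (Projectivization F V) = (Nat.card F + 1) * (Nat.card F ^ 2 + 1) := by
  rw [← Nat.card_eq_fintype_card, card_of_finrank F V hB.finrank_eq]
  simp only [Finset.sum_range_succ, Finset.sum_range_zero]
  ring

theorem card_points_on_line (l : Line B) : #{p | Inc B p l} = Nat.card F + 1 := by
  have := card_points_mem l.1
  rw [card_of_finrank_two F l.1 l.2.1] at this
  rw [← this, Nat.card_eq_fintype_card, Fintype.card_subtype]
  simp only [inc_iff]

variable [Fintype (Line B)]

/-- The points collinear with p form the plane p^⊥, with q² + q + 1 points. The lines on p partition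
the q² + q points other than p into sets of size q. -/
theorem card_lines_on_point (hB : IsSymplectic B) (p : Projectivization F V) :
    #{l | Inc B p l} = Nat.card F + 1 := by
  have h1 := hB.isGQ.card_coll_eq card_points_on_line p
  have h2 := card_points_mem (LinearMap.ker (B p.rep))
  rw [card_of_finrank F _ (hB.finrank_ker_apply p.rep_nonzero), Nat.card_eq_fintype_card,
    Fintype.card_subtype] at h2
  have h3 : (univ.filter fun u => u ≠ p ∧ Coll (Inc B) u p) =
      (univ.filter fun u : Projectivization F V => u.rep ∈ LinearMap.ker (B p.rep)).erase p := by
    ext u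
    simp [hB.coll_iff, hB.apply_eq_zero_comm (x := u.rep)]
  rw [h3, card_erase_of_mem (by simp [hB.alt.self_eq_zero]), h2] at h1
  simp only [Finset.sum_range_succ, Finset.sum_range_zero] at h1
  refine Nat.eq_of_mul_eq_mul_right (Nat.card_pos (α := F)) (h1.symm.trans ?_)
  simp only [zero_add, pow_zero, pow_one, add_assoc, Nat.add_sub_cancel_left]
  ring

theorem card_lines (hB : IsSymplectic B) :
    Fintype.card (Line B) = (Nat.card F + 1) * (Nat.card F ^ 2 + 1) :=
  (card_lines_eq card_points_on_line hB.card_lines_on_point).trans hB.card_points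

end IsSymplectic

end SymplecticQuadrangle

/-! ### A family of 4q vectors separating linear forms -/

section Separating

open Module

variable {F V : Type*} [Field F] [AddCommGroup V] [Module F V]

/-- In a finite field, some `c` is not of the form `x ^ 2 - x`. -/
theorem exists_forall_sq_ne_add [Finite F] : ∃ c : F, ∀ x : F, x ^ 2 ≠ x + c := by
  by_contra! h
  have hs : Function.Surjective fun x : F => x ^ 2 - x := fun c => by
    obtain ⟨x, hx⟩ := h c
    exact ⟨x, by simp [hx]⟩
  have := Finite.injective_iff_surjective.mpr hs
  -- The map x ↦ x² - x takes the value 0 at both 0 and 1, so on a finite field it cannot be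
  -- surjective.
  exact zero_ne_one (@this 0 1 (by simp))

/-- A linear form on `F²` is determined up to a scalar by its zeros among the vectors `(t, 1)`. -/
theorem exists_eq_mul_of_zeros {f₀ f₁ g₀ g₁ : F} (h : ∀ t, t * f₀ + f₁ = 0 ↔ t * g₀ + g₁ = 0) :
    ∃ a : F, a ≠ 0 ∧ g₀ = a * f₀ ∧ g₁ = a * f₁ := by
  -- If g₀ = 0, the zero of f forces g₁ = 0, so g and hence f vanish at every t; two consecutive
  -- values of t then give f₀ = 0.
  have key : ∀ {f₀ f₁ g₀ g₁ : F}, (∀ t, t * f₀ + f₁ = 0 ↔ t * g₀ + g₁ = 0) → f₀ ≠ 0 → g₀ ≠ 0 := by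
    rintro f₀ f₁ g₀ g₁ h hf rfl
    have h1 := (h (-f₁ / f₀)).mp (by field_simp; ring)
    have h2 := (h (-f₁ / f₀ + 1)).mpr (by simpa using h1)
    apply hf
    field_simp at h2
    linear_combination h2
  by_cases hf : f₀ = 0
  · have hg : g₀ = 0 := by
      by_contra hg
      exact key (fun t => (h t).symm) hg hf
    subst hf hg
    have h0 := h 0
    simp only [mul_zero, zero_add] at h0
    by_cases hf1 : f₁ = 0
    · exact ⟨1, one_ne_zero, by simp, by simp [hf1, h0.mp hf1]⟩
    · have hg1 : g₁ ≠ 0 := fun h => hf1 (h0.mpr h)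
      exact ⟨g₁ / f₁, div_ne_zero hg1 hf1, by simp, by field_simp⟩
  · have hg := key h hf
    have h1 := (h (-f₁ / f₀)).mp (by field_simp; ring)
    refine ⟨g₀ / f₀, div_ne_zero hg hf, by field_simp, ?_⟩
    field_simp at h1 ⊢
    linear_combination h1

/-- The pairs f and g are the restrictions of a form to two skew lines, rescaled by α and β; γ and δ
come from two further lines. If f, g are nonzero and α ≠ β, the third line forces g = k f with k ≠
0. The fourth then forces f₁ = r f₀ and c f₀ + f₁ = r f₁, so r² = r + c, against the choice of c. -/
theorem exists_common_factor {c : F} (hc : ∀ x : F, x ^ 2 ≠ x + c) {f₀ f₁ g₀ g₁ α β γ δ : F}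
    (hα : α ≠ 0) (hβ : β ≠ 0) (h0 : α * f₀ + β * g₀ = γ * (f₀ + g₀))
    (h1 : α * f₁ + β * g₁ = γ * (f₁ + g₁)) (h2 : α * f₀ + β * g₁ = δ * (f₀ + g₁))
    (h3 : α * f₁ + β * (c * g₀ + g₁) = δ * (f₁ + (c * g₀ + g₁))) :
    ∃ r : F, r ≠ 0 ∧ α * f₀ = r * f₀ ∧ α * f₁ = r * f₁ ∧ β * g₀ = r * g₀ ∧ β * g₁ = r * g₁ := by
  by_cases hf : f₀ = 0 ∧ f₁ = 0
  · exact ⟨β, hβ, by simp [hf.1], by simp [hf.2], rfl, rfl⟩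
  by_cases hg : g₀ = 0 ∧ g₁ = 0
  · exact ⟨α, hα, rfl, rfl, by simp [hg.1], by simp [hg.2]⟩
  by_cases hαβ : α = β
  · exact ⟨α, hα, rfl, rfl, by rw [hαβ], by rw [hαβ]⟩
  exfalso
  have e0 : (γ - β) * g₀ = (α - γ) * f₀ := by linear_combination -h0
  have e1 : (γ - β) * g₁ = (α - γ) * f₁ := by linear_combination -h1
  have hγβ : γ - β ≠ 0 := by
    intro h
    have h' : α - γ ≠ 0 := fun h' => hαβ (by linear_combination h + h')
    rw [h, zero_mul, eq_comm, mul_eq_zero] at e0 e1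
    exact hf ⟨e0.resolve_left h', e1.resolve_left h'⟩
  have hαγ : α - γ ≠ 0 := by
    intro h
    rw [h, zero_mul, mul_eq_zero] at e0 e1
    exact hg ⟨e0.resolve_left hγβ, e1.resolve_left hγβ⟩
  obtain ⟨k, hk, hk0⟩ : ∃ k, k ≠ 0 ∧ (γ - β) * k = α - γ :=
    ⟨(α - γ) / (γ - β), div_ne_zero hαγ hγβ, by field_simp⟩
  have e0' : g₀ = k * f₀ := mul_left_cancel₀ hγβ (by linear_combination e0 - f₀ * hk0)
  have e1' : g₁ = k * f₁ := mul_left_cancel₀ hγβ (by linear_combination e1 - f₁ * hk0)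
  subst e0' e1'
  have hδβ : (δ - β) * k ≠ 0 := by
    refine mul_ne_zero (fun h => ?_) hk
    have hδα : α - δ ≠ 0 := fun h' => hαβ (by linear_combination h + h')
    refine hf ⟨mul_left_cancel₀ hδα ?_, mul_left_cancel₀ hδα ?_⟩
    · linear_combination h2 + k * f₁ * h
    · linear_combination h3 + (c * (k * f₀) + k * f₁) * h
  obtain ⟨r, hr⟩ : ∃ r, (δ - β) * k * r = α - δ := 
    ⟨((δ - β) * k)⁻¹ * (α - δ), mul_inv_cancel_left₀ hδβ _⟩
  have e2 : f₁ = r * f₀ := mul_left_cancel₀ hδβ (by linear_combination -h2 - f₀ * hr)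
  have e3 : c * f₀ + f₁ = r * f₁ := mul_left_cancel₀ hδβ (by linear_combination -h3 - f₁ * hr)
  have hf0 : f₀ ≠ 0 := fun h => hf ⟨h, by rw [e2, h, mul_zero]⟩
  exact hc r (mul_right_cancel₀ hf0 (by rw [e2] at e3; linear_combination -e3))

/-- There are `4q` vectors of a four-dimensional space, `q` of them on each of four lines without
a common transversal, such that a linear form is determined up to a scalar by its zeros among
these vectors. -/
theorem exists_separating_family [Finite F] (b : Basis (Fin 4) F V) :
    ∃ a : Fin 4 → F → V, (∀ i t, a i t ≠ 0) ∧ (∀ t, a 0 t = t • b 0 + b 1) ∧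
      ∀ φ ψ : V →ₗ[F] F, (∀ i t, φ (a i t) = 0 ↔ ψ (a i t) = 0) → ∃ r : F, r ≠ 0 ∧ ψ = r • φ := by
  obtain ⟨c, hc⟩ := exists_forall_sq_ne_add (F := F)
  -- The last two lines are graphs of maps from ⟨b 0, b 1⟩ to ⟨b 2, b 3⟩: one sends b 0, b 1 to b 2,
  -- b 3, the other to b 3, c b 2 + b 3. Relative to each other they have characteristic polynomial
  -- x² - x - c, which has no root, so the four lines have no common transversal.
  refine ⟨![fun t => t • b 0 + b 1, fun t => t • b 2 + b 3,
    fun t => t • b 0 + b 1 + t • b 2 + b 3, fun t => t • b 0 + b 1 + c • b 2 + (t + 1) • b 3],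
    ?_, fun t => rfl, ?_⟩
  · intro i t h
    fin_cases i
    · simpa using congrArg (fun v => b.repr v 1) h
    · simpa using congrArg (fun v => b.repr v 3) h
    · simpa using congrArg (fun v => b.repr v 1) h
    · simpa using congrArg (fun v => b.repr v 1) h
  · intro φ ψ h
    have h0 := h 0
    have h1 := h 1
    have h2 := h 2
    have h3 := h 3
    simp only [Matrix.cons_val, map_add, map_smul, smul_eq_mul] at h0 h1 h2 h3
    obtain ⟨α, hα, a0, a1⟩ := exists_eq_mul_of_zeros h0
    obtain ⟨β, hβ, b0, b1⟩ := exists_eq_mul_of_zeros h1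
    obtain ⟨γ, -, c0, c1⟩ := exists_eq_mul_of_zeros (f₀ := φ (b 0) + φ (b 2))
      (f₁ := φ (b 1) + φ (b 3)) (g₀ := ψ (b 0) + ψ (b 2)) (g₁ := ψ (b 1) + ψ (b 3))
      (fun t => by convert h2 t using 2 <;> ring)
    obtain ⟨δ, -, d0, d1⟩ := exists_eq_mul_of_zeros (f₀ := φ (b 0) + φ (b 3))
      (f₁ := φ (b 1) + (c * φ (b 2) + φ (b 3))) (g₀ := ψ (b 0) + ψ (b 3))
      (g₁ := ψ (b 1) + (c * ψ (b 2) + ψ (b 3)))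
      (fun t => by convert h3 t using 2 <;> ring)
    rw [a0, b0] at c0
    rw [a1, b1] at c1
    rw [a0, b1] at d0
    rw [a1, b0, b1] at d1
    obtain ⟨r, hr, r0, r1, r2, r3⟩ := exists_common_factor hc hα hβ c0 c1 d0
      (by linear_combination d1)
    refine ⟨r, hr, b.ext fun i => ?_⟩
    fin_cases i
    · exact a0.trans r0
    · exact a1.trans r1
    · exact b0.trans r2
    · exact b1.trans r3

end Separating

/-! ### Symplectic bases -/

namespace SymplecticQuadrangle

open Module

variable {F V : Type*} [Field F] [AddCommGroup V] [Module F V] {B : LinearMap.BilinForm F V}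

namespace IsSymplectic

theorem exists_apply_eq_one (hB : IsSymplectic B) {u : V} (hu : u ≠ 0) : ∃ v, B u v = 1 := by
  have : ∃ v, B u v ≠ 0 := by
    by_contra! h
    exact hu (hB.nondeg.1 u h)
  obtain ⟨v, hv⟩ := this
  exact ⟨(B u v)⁻¹ • v, by simp [hv]⟩

/-- A symplectic form in dimension four has a symplectic basis. -/
theorem exists_basis (hB : IsSymplectic B) : ∃ b : Basis (Fin 4) F V, B (b 0) (b 1) = 0 ∧
    B (b 0) (b 2) = 0 ∧ B (b 0) (b 3) = 1 ∧ B (b 1) (b 2) = 1 ∧ B (b 1) (b 3) = 0 ∧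
    B (b 2) (b 3) = 0 := by
  have := hB.finiteDimensional
  have : Nontrivial V := nontrivial_of_finrank_pos (R := F) (by rw [hB.finrank_eq]; simp)
  obtain ⟨x, hx⟩ := exists_ne (0 : V)
  obtain ⟨w, hxw⟩ := hB.exists_apply_eq_one hx
  have hlt : 0 < finrank F (B.orthogonal (Submodule.span F {x, w})) := by
    have h1 : finrank F (Submodule.span F {x, w}) ≤ 2 := by
      classical
      have := finrank_span_finset_le_card (R := F) ({x, w} : Finset V)
      rw [Finset.coe_pair] at this
      exact this.trans Finset.card_le_two
    rw [LinearMap.BilinForm.finrank_orthogonal hB.nondeg, hB.finrank_eq]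
    omega
  obtain ⟨⟨y, hy⟩, hy0⟩ := (finrank_pos_iff_exists_ne_zero (R := F)).mp hlt
  have hy0 : y ≠ 0 := by simpa using hy0
  have hxy : B x y = 0 := hy x (Submodule.subset_span (by simp))
  have hwy : B w y = 0 := hy w (Submodule.subset_span (by simp))
  obtain ⟨z', hz'⟩ := hB.exists_apply_eq_one hy0
  -- The dual partner of y is corrected to be orthogonal to the hyperbolic pair x, w; since y is
  -- orthogonal to both, B y z stays 1.
  obtain ⟨z, hxz, hyz, hzw⟩ : ∃ z, B x z = 0 ∧ B y z = 1 ∧ B z w = 0 := by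
    refine ⟨z' + (B w z') • x - (B x z') • w, ?_, ?_, ?_⟩
    · simp [hB.alt.self_eq_zero, hxw]
    · simp [hz', hB.apply_comm x y, hB.apply_comm w y, hxy, hwy]
    · simp [hB.alt.self_eq_zero, hxw, hB.apply_comm w z']
  have hyw : B y w = 0 := hB.apply_eq_zero_comm.mp hwy
  have hli : LinearIndependent F ![x, y, z, w] := by
    rw [Fintype.linearIndependent_iff]
    intro g hg
    simp only [Fin.sum_univ_four, Matrix.cons_val] at hg
    have e0 := congrArg (B x) hg
    have e1 := congrArg (B y) hg
    have e2 := congrArg (B z) hg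
    have e3 := congrArg (B w) hg
    simp only [map_add, map_smul, smul_eq_mul, map_zero, hB.alt.self_eq_zero, hxy, hxz, hxw,
      hyz, hyw, hzw, hwy, hB.apply_comm x y, hB.apply_comm x z, hB.apply_comm x w,
      hB.apply_comm y z, hB.apply_comm z w] at e0 e1 e2 e3
    intro i
    fin_cases i
    · simpa using e3
    · simpa using e2
    · simpa using e1
    · simpa using e0
  refine ⟨basisOfLinearIndependentOfCardEqFinrank hli (by simp [hB.finrank_eq]), ?_⟩
  simp only [coe_basisOfLinearIndependentOfCardEqFinrank, Matrix.cons_val]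
  exact ⟨hxy, hxz, hxw, hyz, hyw, hzw⟩

end IsSymplectic

end SymplecticQuadrangle

/-! ### Resolving lines under antiregularity -/

section LineResolving

open Finset Classical

variable {P L : Type*} {I : P → L → Prop} [Fintype P] [Fintype L]

/-- In a generalized quadrangle of order `(q, q)` with an antiregularity property for the line `m`,
the lines are resolved by the points of `m` other than `a₁` together with at most `4q - 1` lines. -/
theorem IsGQ.exists_resolving_lines (h : IsGQ I) {q : ℕ} (hq : 1 ≤ q)
    (hl : ∀ l, #{p | I p l} = q + 1) (hp : ∀ p, #{l | I p l} = q + 1) {m : L} {a₁ a₂ a₃ : P}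
    (h1 : I a₁ m) (h2 : I a₂ m) (h3 : I a₃ m) (h12 : a₁ ≠ a₂) (h13 : a₁ ≠ a₃) (h23 : a₂ ≠ a₃)
    (hanti : ∀ l l', l ≠ l' → (∀ p, I p m → ¬ I p l) → (∀ p, I p m → ¬ I p l') →
      ∀ m₁ m₂ m₃, I a₁ m₁ → I a₂ m₂ → I a₃ m₃ → (∀ k ∈ [m₁, m₂, m₃],
        Coll (fun l p => I p l) l k ∧ Coll (fun l p => I p l) l' k) → False)
    {A : Finset P} (hA : ∀ b, I b m → b ≠ a₁ → b ∈ A) :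
    ∃ C : Finset L, #C + 1 ≤ 4 * q ∧ ResolvesPoints (fun l p => I p l) C A := by
  have hpen : ∀ p k, ∃ k', I p k' ∧ k' ≠ k := fun p k => by
    have : 1 < #{l | I p l} := by rw [hp]; omega
    obtain ⟨k', hk', hne⟩ := exists_mem_ne this k
    exact ⟨k', by simpa using hk', hne⟩
  obtain ⟨n, hn1, hnm⟩ := hpen a₁ m
  obtain ⟨a₄, hn4, h41⟩ : ∃ a₄, I a₄ n ∧ a₄ ≠ a₁ := by
    have : 1 < #{p | I p n} := by rw [hl]; omega
    obtain ⟨a, ha, hne⟩ := exists_mem_ne this a₁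
    exact ⟨a, by simpa using ha, hne⟩
  obtain ⟨k₀, hk4, hkn⟩ := hpen a₄ n
  have h4m : ¬ I a₄ m := fun h4m => (h.inter a₄ a₁ n m hn4 hn1 h4m h1).elim h41 hnm
  -- Three pencils without m give 3q lines. The pencil at a₄ without n and k₀ adds q - 1: the line n
  -- meets m in a₁, and one further line can be spared because a single unlisted projection is
  -- identified by elimination.
  let T : P → Finset L := fun p => (univ.filter fun l => I p l).erase m
  have hT : ∀ p, I p m → #(T p) = q := fun p hpm => by
    rw [card_erase_of_mem (by simpa using hpm), hp, Nat.add_sub_cancel]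
  let D : Finset L := ((univ.filter fun l => I a₄ l).erase n).erase k₀
  have hD : #D + 1 = q := by
    rw [card_erase_of_mem (by simpa using ⟨hkn, hk4⟩), card_erase_of_mem (by simpa using hn4), hp]
    omega
  refine ⟨T a₁ ∪ T a₂ ∪ T a₃ ∪ D, ?_, ?_⟩
  · have c1 := card_union_le (T a₁ ∪ T a₂ ∪ T a₃) D
    have c2 := card_union_le (T a₁ ∪ T a₂) (T a₃)
    have c3 := card_union_le (T a₁) (T a₂)
    rw [hT _ h1, hT _ h2] at c3
    rw [hT _ h3] at c2
    omega
  set C := T a₁ ∪ T a₂ ∪ T a₃ ∪ D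
  have hC : ∀ l, l ≠ m → (I a₁ l ∨ I a₂ l ∨ I a₃ l) → l ∈ C := by
    intro l hlm hla
    simp only [C, T, mem_union, mem_erase, mem_filter, mem_univ, true_and]
    tauto
  have hC' : ∀ k, I a₄ k → k ≠ n → k ≠ k₀ → k ∈ C := by
    intro k hk hkn hkk
    simp only [C, D, mem_union, mem_erase, mem_filter, mem_univ, true_and]
    tauto
  -- This treats lines meeting m. If the intersection point b is not a₁, then b is in `A`, so both
  -- lines pass through b; they are told apart by the lines through a₄ that they meet.
  have key : ∀ l l', (∀ s ∈ C, (l = s ↔ l' = s) ∧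
      (Coll (fun l p => I p l) l s ↔ Coll (fun l p => I p l) l' s)) →
      (∀ p ∈ A, I p l ↔ I p l') → (∃ b, I b m ∧ I b l) → l = l' := by
    rintro l l' e1 e2 ⟨b, hbm, hbl⟩
    have i2 := e2 a₂ (hA a₂ h2 h12.symm)
    have i3 := e2 a₃ (hA a₃ h3 h13.symm)
    by_contra hne
    have hlm : l ≠ m := by
      rintro rfl
      exact (h.inter a₂ a₃ l l' h2 h3 (i2.mp h2) (i3.mp h3)).elim h23 hne
    have hlm' : l' ≠ m := by
      rintro rfl
      exact (h.inter a₂ a₃ l l' (i2.mpr h2) (i3.mpr h3) h2 h3).elim h23 hne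
    have hb1 : b ≠ a₁ := by
      rintro rfl
      exact hne ((e1 l (hC l hlm (.inl hbl))).1.mp rfl).symm
    have hbl' : I b l' := (e2 b (hA b hbm hb1)).mp hbl
    have hb4 : ∀ k, I a₄ k → ¬ I b k := fun k hk hbk =>
      hb1 (h.proj_unique a₄ m h4m b k a₁ n hk hbk hbm hn4 hn1 h1).1
    have hk : ∀ k, I a₄ k → Coll (fun l p => I p l) l k → Coll (fun l p => I p l) l' k →
        False := by
      rintro k hk ⟨x, hx, hxk⟩ ⟨x', hx', hxk'⟩
      exact hne (h.proj_unique b k (hb4 k hk) x l x' l' hbl hx hxk hbl' hx' hxk').2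
    have hnc : ∀ j, j ≠ m → I b j → ¬ Coll (fun l p => I p l) j n := by
      rintro j hj hbj ⟨x, hx, hxn⟩
      exact hj (h.proj_unique b n (hb4 n hn4) x j a₁ m hbj hx hxn hbm h1 hn1).2
    have hproj : ∀ j, I b j → ∃ k, I a₄ k ∧ Coll (fun l p => I p l) j k := by
      intro j hbj
      obtain ⟨x, k, hk, hxk, hxj⟩ := h.proj a₄ j (fun h4 => hb4 j h4 hbj)
      exact ⟨k, hk, x, hxj, hxk⟩
    obtain ⟨k, hk4, hlk⟩ := hproj l hbl
    obtain ⟨k', hk4', hlk'⟩ := hproj l' hbl'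
    have hkn : k ≠ n := by rintro rfl; exact hnc l hlm hbl hlk
    have hkn' : k' ≠ n := by rintro rfl; exact hnc l' hlm' hbl' hlk'
    by_cases hkk : k = k₀
    · by_cases hkk' : k' = k₀
      · exact hk k hk4 hlk (by rwa [hkk, ← hkk'])
      · exact hk k' hk4' ((e1 k' (hC' k' hk4' hkn' hkk')).2.mpr hlk') hlk'
    · exact hk k hk4 hlk ((e1 k (hC' k hk4 hkn hkk)).2.mp hlk)
  intro l l' e1 e2
  by_cases hb : ∃ b, I b m ∧ I b l
  · exact key l l' e1 e2 hb
  by_cases hb' : ∃ b, I b m ∧ I b l'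
  · exact (key l' l (fun s hs => ⟨(e1 s hs).1.symm, (e1 s hs).2.symm⟩)
      (fun p hp => (e2 p hp).symm) hb').symm
  push Not at hb hb'
  by_contra hne
  -- For lines disjoint from m, the transversal from each aᵢ to l is a landmark and so also meets
  -- l'; antiregularity excludes three of these.
  have hm : ∀ a, (a = a₁ ∨ a = a₂ ∨ a = a₃) → I a m → ∃ k, I a k ∧
      Coll (fun l p => I p l) l k ∧ Coll (fun l p => I p l) l' k := by
    intro a ha ham
    obtain ⟨x, k, hak, hxk, hxl⟩ := h.proj a l (hb a ham)
    have hkm : k ≠ m := by rintro rfl; exact hb x hxk hxl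
    have hkC : k ∈ C := hC k hkm (by rcases ha with rfl | rfl | rfl <;> tauto)
    exact ⟨k, hak, ⟨x, hxl, hxk⟩, (e1 k hkC).2.mp ⟨x, hxl, hxk⟩⟩
  obtain ⟨m₁, hm1, hm1'⟩ := hm a₁ (by tauto) h1
  obtain ⟨m₂, hm2, hm2'⟩ := hm a₂ (by tauto) h2
  obtain ⟨m₃, hm3, hm3'⟩ := hm a₃ (by tauto) h3
  exact hanti l l' hne hb hb' m₁ m₂ m₃ hm1 hm2 hm3 (by simp [hm1', hm2', hm3'])

end LineResolving

/-! ### Point separation, and antiregularity of lines in odd characteristic -/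

namespace SymplecticQuadrangle

open Projectivization Module

variable {F V : Type*} [Field F] [AddCommGroup V] [Module F V] {B : LinearMap.BilinForm F V}

theorem apply_rep_mk_eq_zero_iff {u w : V} {hw : w ≠ 0} :
    B u (Projectivization.mk F w hw).rep = 0 ↔ B u w = 0 := by
  obtain ⟨a, ha⟩ := exists_smul_eq_mk_rep F w hw
  rw [← ha, Units.smul_def, map_smul, smul_eq_mul]
  simp

theorem eq_of_rep_eq_smul {u v : Projectivization F V} {r : F} (h : v.rep = r • u.rep) :
    v = u := by
  rw [← mk_rep u, ← mk_rep v, mk_eq_mk_iff']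
  exact ⟨r, h.symm⟩

namespace IsSymplectic

/-- By nondegeneracy u is determined up to a scalar by the form B(u, ·), so collinearity with the
points of `A` alone suffices, whatever `C` is. -/
theorem resolvesPoints_of_separating (hB : IsSymplectic B) {ι : Type*} {a : ι → V}
    (ha0 : ∀ i, a i ≠ 0) (ha : ∀ φ ψ : V →ₗ[F] F, (∀ i, φ (a i) = 0 ↔ ψ (a i) = 0) →
      ∃ r : F, r ≠ 0 ∧ ψ = r • φ) {A : Finset (Projectivization F V)}
    (hA : ∀ i, Projectivization.mk F (a i) (ha0 i) ∈ A) (C : Finset (Line B)) :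
    ResolvesPoints (Inc B) A C := by
  intro u v h _
  obtain ⟨r, hr, he⟩ := ha (B u.rep) (B v.rep) fun i => by
    have := (h _ (hA i)).2
    rwa [hB.coll_iff, hB.coll_iff, apply_rep_mk_eq_zero_iff, apply_rep_mk_eq_zero_iff] at this
  refine (eq_of_rep_eq_smul (r := r) ?_).symm
  rw [← sub_eq_zero]
  refine hB.nondeg.1 _ fun y => ?_
  rw [map_sub, map_smul, he, sub_self, LinearMap.zero_apply]

/-- In odd characteristic, a line `m` and two further lines `l`, `l'` which are pairwise disjoint
have at most two common transversals. -/
theorem false_of_three_transversals (hB : IsSymplectic B) (hF : (2 : F) ≠ 0) {m l l' : Line B}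
    {a₁ a₂ a₃ : Projectivization F V} (h1 : Inc B a₁ m) (h2 : Inc B a₂ m) (h3 : Inc B a₃ m)
    (h12 : a₁ ≠ a₂) (h13 : a₁ ≠ a₃) (h23 : a₂ ≠ a₃)
    (hl : ∀ p, Inc B p m → ¬ Inc B p l) (hl' : ∀ p, Inc B p m → ¬ Inc B p l')
    (hll : ∀ p, Inc B p l → ¬ Inc B p l') {m₁ m₂ m₃ : Line B} (hm1 : Inc B a₁ m₁)
    (hm2 : Inc B a₂ m₂) (hm3 : Inc B a₃ m₃) (hk : ∀ k ∈ [m₁, m₂, m₃],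
      Coll (fun l p => Inc B p l) l k ∧ Coll (fun l p => Inc B p l) l' k) : False := by
  have hdisj : ∀ {k k' : Line B}, (∀ p, Inc B p k → ¬ Inc B p k') →
      ∀ z, z ∈ k.1 → z ∈ k'.1 → z = 0 := by
    intro k k' h z hz hz'
    by_contra hz0
    exact h (Projectivization.mk F z hz0) (inc_mk.mpr hz) (inc_mk.mpr hz')
  -- A transversal through a joins a point of l to a point of l', which splits a along l ⊕ l' into
  -- two orthogonal components.
  have hsplit : ∀ (a : Projectivization F V) (k : Line B), Inc B a k →
      Coll (fun l p => Inc B p l) l k → Coll (fun l p => Inc B p l) l' k →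
      ∃ x y, a.rep = x + y ∧ x ∈ l.1 ∧ y ∈ l'.1 ∧ B x y = 0 := by
    rintro a k hak ⟨x, hx, hxk⟩ ⟨y, hy, hyk⟩
    have hxy : x ≠ y := by rintro rfl; exact hll x hx hy
    rw [inc_iff] at *
    rw [k.eq_span (linearIndependent_rep hxy) hxk hyk] at hak
    obtain ⟨s, t, hst⟩ := Submodule.mem_span_pair.mp hak
    refine ⟨s • x.rep, t • y.rep, hst.symm, l.1.smul_mem _ hx, l'.1.smul_mem _ hy, ?_⟩
    exact k.apply_eq_zero (k.1.smul_mem _ hxk) (k.1.smul_mem _ hyk)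
  obtain ⟨x₁, y₁, e1, hx1, hy1, b1⟩ := hsplit a₁ m₁ hm1 (hk m₁ (by simp)).1 (hk m₁ (by simp)).2
  obtain ⟨x₂, y₂, e2, hx2, hy2, b2⟩ := hsplit a₂ m₂ hm2 (hk m₂ (by simp)).1 (hk m₂ (by simp)).2
  obtain ⟨x₃, y₃, e3, hx3, hy3, b3⟩ := hsplit a₃ m₃ hm3 (hk m₃ (by simp)).1 (hk m₃ (by simp)).2
  have hind := linearIndependent_rep h12
  rw [inc_iff] at h1 h2 h3
  have hm := m.eq_span hind h1 h2
  have h3' := h3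
  rw [hm] at h3'
  obtain ⟨α, β, hαβ⟩ := Submodule.mem_span_pair.mp h3'
  have hα : α ≠ 0 := by
    rintro rfl
    rw [zero_smul, zero_add] at hαβ
    exact h23 (eq_of_rep_eq_smul hαβ.symm).symm
  have hβ : β ≠ 0 := by
    rintro rfl
    rw [zero_smul, add_zero] at hαβ
    exact h13 (eq_of_rep_eq_smul hαβ.symm).symm
  have hx0 : x₃ - α • x₁ - β • x₂ = 0 := by
    refine hdisj hll _ (l.1.sub_mem (l.1.sub_mem hx3 (l.1.smul_mem _ hx1)) (l.1.smul_mem _ hx2)) ?_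
    have : x₃ - α • x₁ - β • x₂ = α • y₁ + β • y₂ - y₃ := by
      rw [e1, e2, e3] at hαβ
      rw [← sub_eq_zero, ← sub_eq_zero.mpr hαβ.symm]
      module
    rw [this]
    exact l'.1.sub_mem (l'.1.add_mem (l'.1.smul_mem _ hy1) (l'.1.smul_mem _ hy2)) hy3
  have hx3e : x₃ = α • x₁ + β • x₂ := by
    rw [← sub_eq_zero, ← hx0]; module
  have hy3e : y₃ = α • y₁ + β • y₂ := by
    rw [e1, e2, e3, hx3e] at hαβ
    rw [← sub_eq_zero, ← sub_eq_zero.mpr hαβ.symm]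
    module
  -- Isotropy of m gives one relation between B x₁ y₂ and B x₂ y₁, and the third transversal gives
  -- the one with opposite sign; as 2 ≠ 0, both values vanish. Then x₁ is orthogonal to y₁ and y₂,
  -- which span l', so x₁ lies in l ∩ l' and is zero, placing a₁ on l'.
  have c1 : B x₁ y₂ - B x₂ y₁ = 0 := by
    have := m.apply_eq_zero h1 h2
    rw [e1, e2] at this
    simp only [map_add, LinearMap.add_apply, l.apply_eq_zero hx1 hx2, l'.apply_eq_zero hy1 hy2,
      hB.apply_comm x₂ y₁] at this
    linear_combination this
  have c2 : B x₁ y₂ + B x₂ y₁ = 0 := by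
    rw [hx3e, hy3e] at b3
    simp only [map_add, map_smul, LinearMap.add_apply, LinearMap.smul_apply, smul_eq_mul, b1,
      b2] at b3
    refine mul_left_cancel₀ (mul_ne_zero hα hβ) ?_
    linear_combination b3
  have c3 : B x₁ y₂ = 0 := by
    refine mul_left_cancel₀ hF ?_
    linear_combination c1 + c2
  have hy : LinearIndependent F ![y₁, y₂] := by
    rw [LinearIndependent.pair_iff]
    intro s t hst
    refine LinearIndependent.pair_iff.mp hind s t (hdisj hl _ ?_ ?_)
    · exact m.1.add_mem (m.1.smul_mem _ h1) (m.1.smul_mem _ h2)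
    · have : s • a₁.rep + t • a₂.rep = s • x₁ + t • x₂ := by
        rw [e1, e2, ← sub_eq_zero, ← hst]; module
      rw [this]
      exact l.1.add_mem (l.1.smul_mem _ hx1) (l.1.smul_mem _ hx2)
  have hx1l' : x₁ ∈ l'.1 := by
    refine l'.mem_of_forall fun z hz => ?_
    rw [l'.eq_span hy hy1 hy2] at hz
    obtain ⟨s, t, rfl⟩ := Submodule.mem_span_pair.mp hz
    rw [hB.apply_eq_zero_comm]
    simp [b1, c3]
  have hx10 := hdisj hll x₁ hx1 hx1l'
  rw [hx10, zero_add] at e1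
  exact hl' a₁ (inc_iff.mpr h1) (inc_iff.mpr (e1 ▸ hy1))

end IsSymplectic

end SymplecticQuadrangle

/-! ### Plücker coordinates and concurrency of lines -/

section Determinant

open Module

variable {F V : Type*} [Field F] [AddCommGroup V] [Module F V]

theorem det_toMatrix_eq_zero_iff (b : Basis (Fin 4) F V) (w : Fin 4 → V) :
    (b.toMatrix w).det = 0 ↔ ∃ g : Fin 4 → F, g ≠ 0 ∧ ∑ j, g j • w j = 0 := by
  rw [← Matrix.exists_mulVec_eq_zero_iff]
  refine exists_congr fun g => and_congr_right fun _ => ?_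
  have : (b.toMatrix w).mulVec g = b.equivFun (∑ j, g j • w j) := by
    ext i
    simp [Matrix.mulVec, dotProduct, Basis.toMatrix_apply, mul_comm]
  rw [this, b.equivFun.map_eq_zero_iff]

theorem inf_span_pair_nontrivial_iff (b : Basis (Fin 4) F V) {x y x' y' : V}
    (h : LinearIndependent F ![x, y]) (h' : LinearIndependent F ![x', y']) :
    (∃ z, z ≠ 0 ∧ z ∈ Submodule.span F {x, y} ∧ z ∈ Submodule.span F {x', y'}) ↔
      (b.toMatrix ![x, y, x', y']).det = 0 := by
  rw [det_toMatrix_eq_zero_iff]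
  constructor
  · rintro ⟨z, hz, h1, h2⟩
    obtain ⟨s, t, rfl⟩ := Submodule.mem_span_pair.mp h1
    obtain ⟨s', t', he⟩ := Submodule.mem_span_pair.mp h2
    refine ⟨![s, t, -s', -t'], fun h0 => hz ?_, ?_⟩
    · have e0 := congrFun h0 0
      have e1 := congrFun h0 1
      simp only [Matrix.cons_val, Pi.zero_apply] at e0 e1
      simp [e0, e1]
    · simp only [Fin.sum_univ_four, Matrix.cons_val]
      rw [← sub_eq_zero.mpr he.symm]
      module
  · rintro ⟨g, hg, h0⟩
    simp only [Fin.sum_univ_four, Matrix.cons_val] at h0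
    have he : g 0 • x + g 1 • y = (-g 2) • x' + (-g 3) • y' := by
      rw [← sub_eq_zero, ← h0]; module
    refine ⟨g 0 • x + g 1 • y, fun hz => hg ?_, Submodule.mem_span_pair.mpr ⟨_, _, rfl⟩,
      Submodule.mem_span_pair.mpr ⟨_, _, he.symm⟩⟩
    obtain ⟨g0, g1⟩ := LinearIndependent.pair_iff.mp h _ _ hz
    obtain ⟨g2, g3⟩ := LinearIndependent.pair_iff.mp h' _ _ (he.symm.trans hz)
    ext i
    fin_cases i
    · exact g0
    · exact g1
    · exact neg_eq_zero.mp g2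
    · exact neg_eq_zero.mp g3

variable (F) in
/-- The bilinear form on the Plücker coordinates `01, 02, 13, 23`. -/
def pluckerForm : (Fin 4 → F) →ₗ[F] (Fin 4 → F) →ₗ[F] F :=
  LinearMap.mk₂ F (fun w z => w 0 * z 3 - w 1 * z 2 - w 2 * z 1 + w 3 * z 0)
    (by intros; simp; ring) (by intros; simp; ring) (by intros; simp; ring)
    (by intros; simp; ring)

theorem pluckerForm_apply (w z : Fin 4 → F) :
    pluckerForm F w z = w 0 * z 3 - w 1 * z 2 - w 2 * z 1 + w 3 * z 0 := rfl

theorem pluckerForm_injective : Function.Injective (pluckerForm F) := by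
  rw [injective_iff_map_eq_zero]
  intro w hw
  have h := fun z => LinearMap.congr_fun hw z
  simp only [pluckerForm_apply, LinearMap.zero_apply] at h
  ext i
  fin_cases i
  · simpa using h ![0, 0, 0, 1]
  · simpa using h ![0, 0, 1, 0]
  · simpa using h ![0, 1, 0, 0]
  · simpa using h ![1, 0, 0, 0]

/-- The Plücker coordinates `01, 02, 13, 23` of a pair of vectors. -/
noncomputable def plucker (b : Basis (Fin 4) F V) (x y : V) : Fin 4 → F :=
  ![b.repr x 0 * b.repr y 1 - b.repr x 1 * b.repr y 0,
    b.repr x 0 * b.repr y 2 - b.repr x 2 * b.repr y 0,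
    b.repr x 1 * b.repr y 3 - b.repr x 3 * b.repr y 1,
    b.repr x 2 * b.repr y 3 - b.repr x 3 * b.repr y 2]

/-- Laplace expansion along the first two columns, with the terms in the coordinates 03 and 12 kept
apart from the other four. -/
theorem det_toMatrix_eq (b : Basis (Fin 4) F V) (x y x' y' : V) :
    (b.toMatrix ![x, y, x', y']).det = pluckerForm F (plucker b x y) (plucker b x' y') +
      (b.repr x 0 * b.repr y 3 - b.repr x 3 * b.repr y 0) *
        (b.repr x' 1 * b.repr y' 2 - b.repr x' 2 * b.repr y' 1) +
      (b.repr x 1 * b.repr y 2 - b.repr x 2 * b.repr y 1) *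
        (b.repr x' 0 * b.repr y' 3 - b.repr x' 3 * b.repr y' 0) := by
  rw [pluckerForm_apply]
  simp only [plucker, Matrix.det_succ_row_zero, Fin.sum_univ_succ, Matrix.submatrix_apply,
    Basis.toMatrix_apply, Fin.succAbove, Matrix.det_unique]
  simp [Fin.lt_def]
  ring

end Determinant

/-! ### Self-duality in characteristic two and the resolving sets -/

namespace SymplecticQuadrangle

open Projectivization Module

variable {F V : Type*} [Field F] [AddCommGroup V] [Module F V] {B : LinearMap.BilinForm F V}

namespace IsSymplectic

theorem coll_dual_iff {l l' : Line B} : Coll (fun l p => Inc B p l) l l' ↔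
    ∃ z, z ≠ 0 ∧ z ∈ l.1 ∧ z ∈ l'.1 := by
  constructor
  · rintro ⟨p, h1, h2⟩
    exact ⟨p.rep, p.rep_nonzero, inc_iff.mp h1, inc_iff.mp h2⟩
  · rintro ⟨z, hz, h1, h2⟩
    exact ⟨Projectivization.mk F z hz, inc_mk.mpr h1, inc_mk.mpr h2⟩

/-- In characteristic two, the lines of the symplectic quadrangle are represented by vectors in
such a way that two lines meet iff these vectors are orthogonal. -/
theorem exists_line_coordinates (hB : IsSymplectic B) (hF : (2 : F) = 0) :
    ∃ δ : Line B → Fin 4 → F, ∀ l l', Coll (fun l p => Inc B p l) l l' ↔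
      pluckerForm F (δ l) (δ l') = 0 := by
  obtain ⟨b, h01, h02, h03, h12, h13, h23⟩ := hB.exists_basis
  have hBxy : ∀ x y, B x y = (b.repr x 0 * b.repr y 3 - b.repr x 3 * b.repr y 0) +
      (b.repr x 1 * b.repr y 2 - b.repr x 2 * b.repr y 1) := by
    intro x y
    conv_lhs => rw [← b.sum_repr x, ← b.sum_repr y]
    simp only [Fin.sum_univ_four, map_add, map_smul, LinearMap.add_apply, LinearMap.smul_apply,
      smul_eq_mul, hB.alt.self_eq_zero, h01, h02, h03, h12, h13, h23,
      hB.apply_comm (b 0) (b 1), hB.apply_comm (b 0) (b 2), hB.apply_comm (b 0) (b 3),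
      hB.apply_comm (b 1) (b 2), hB.apply_comm (b 1) (b 3), hB.apply_comm (b 2) (b 3)]
    ring
  choose x y hxy hspan using fun l : Line B => l.exists_eq_span
  refine ⟨fun l => plucker b (x l) (y l), fun l l' => ?_⟩
  have hself : ∀ l, B (x l) (y l) = 0 := fun l => by
    refine l.apply_eq_zero ?_ ?_ <;> rw [hspan l] <;> exact Submodule.subset_span (by simp)
  have e := hself l
  have e' := hself l'
  rw [hBxy] at e e'
  rw [coll_dual_iff, hspan l, hspan l', inf_span_pair_nontrivial_iff b (hxy l) (hxy l'),
    det_toMatrix_eq]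
  refine Eq.congr ?_ rfl
  -- Isotropy makes the 03 coordinate the negative of the 12 coordinate, so the two remaining terms
  -- add up to -2 times a product of 12 coordinates, which vanishes in characteristic two.
  rw [eq_neg_of_add_eq_zero_left e, eq_neg_of_add_eq_zero_left e']
  linear_combination (-(b.repr (x l) 1 * b.repr (y l) 2 - b.repr (x l) 2 * b.repr (y l) 1) *
    (b.repr (x l') 1 * b.repr (y l') 2 - b.repr (x l') 2 * b.repr (y l') 1)) * hF

open Finset Classical

variable [Finite F] [Fintype (Projectivization F V)] [Fintype (Line B)]

theorem exists_other_line (hB : IsSymplectic B) (p : Projectivization F V) (l : Line B) :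
    ∃ k, Inc B p k ∧ k ≠ l := by
  have : 1 < #{l | Inc B p l} := by
    rw [hB.card_lines_on_point]
    have := Nat.card_pos (α := F)
    omega
  obtain ⟨k', hk', hne⟩ := exists_mem_ne this l
  exact ⟨k', by simpa using hk', hne⟩

/-- If a point of l were off l', then l and a second line through it would both meet l', forming a
triangle. -/
theorem le_of_forall_coll (hB : IsSymplectic B) {l l' : Line B}
    (h : ∀ k, Coll (fun l p => Inc B p l) l k → Coll (fun l p => Inc B p l) l' k)
    (p : Projectivization F V) (hp : Inc B p l) : Inc B p l' := by
  by_contra hp'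
  obtain ⟨k, hk, hkl⟩ := hB.exists_other_line p l
  obtain ⟨x, hx, hxk⟩ := h k ⟨p, hp, hk⟩
  obtain ⟨x', hx', hxl⟩ := h l ⟨p, hp, hp⟩
  exact hkl (hB.isGQ.proj_unique p l' hp' x k x' l hk hxk hx hp hxl hx').2

theorem eq_of_forall_coll_iff (hB : IsSymplectic B) {l l' : Line B}
    (h : ∀ k, Coll (fun l p => Inc B p l) l k ↔ Coll (fun l p => Inc B p l) l' k) : l = l' := by
  obtain ⟨u, v, huv, hl⟩ := l.exists_eq_span
  have h1 : ∀ z ∈ l.1, z ∈ l'.1 := by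
    intro z hz
    by_cases hz0 : z = 0
    · rw [hz0]; exact l'.1.zero_mem
    · exact inc_mk.mp (hB.le_of_forall_coll (fun k => (h k).mp) (Projectivization.mk F z hz0)
        (inc_mk.mpr hz))
  have hu : u ∈ l.1 := by rw [hl]; exact Submodule.subset_span (by simp)
  have hv : v ∈ l.1 := by rw [hl]; exact Submodule.subset_span (by simp)
  exact Subtype.ext (hl.trans (l'.eq_span huv (h1 u hu) (h1 v hv)).symm)

theorem exists_not_coll (hB : IsSymplectic B) (l : Line B) :
    ∃ k, ¬ Coll (fun l p => Inc B p l) l k := by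
  by_contra! h
  obtain ⟨p, hp⟩ := hB.isGQ.exists_point l
  obtain ⟨v, hv⟩ := hB.exists_apply_eq_one p.rep_nonzero
  have hv0 : v ≠ 0 := by rintro rfl; simp at hv
  have hnot : ¬ Inc B (Projectivization.mk F v hv0) l := fun hvl => by
    have := l.apply_eq_zero (inc_iff.mp hp) (inc_mk.mp hvl)
    rw [hv] at this
    exact one_ne_zero this
  obtain ⟨k, hk⟩ := hB.isGQ.exists_line (Projectivization.mk F v hv0)
  exact hnot (hB.le_of_forall_coll (fun j _ => h j) _ hk)

/-- In characteristic two, `4q` lines suffice to resolve the lines of the symplectic quadrangle. -/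
theorem exists_resolving_lines_of_two_eq_zero (hB : IsSymplectic B) (hF : (2 : F) = 0)
    (A : Finset (Projectivization F V)) :
    ∃ C : Finset (Line B), #C ≤ 4 * Nat.card F ∧
      ResolvesPoints (fun l p => Inc B p l) C A := by
  obtain ⟨δ, hδ⟩ := hB.exists_line_coordinates hF
  have hδ0 : ∀ l, δ l ≠ 0 := fun l h0 => by
    obtain ⟨k, hk⟩ := hB.exists_not_coll l
    exact hk ((hδ l k).mpr (by simp [h0]))
  have hinj : ∀ l l' (r : F), r ≠ 0 → δ l' = r • δ l → l = l' := fun l l' r hr h =>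
    hB.eq_of_forall_coll_iff fun k => by simp [hδ, h, hr]
  let f : Line B → Projectivization F (Fin 4 → F) := fun l => Projectivization.mk F (δ l) (hδ0 l)
  have hf : Function.Injective f := by
    intro l l' h
    obtain ⟨a, ha⟩ := (mk_eq_mk_iff F _ _ (hδ0 l') (hδ0 l)).mp h.symm
    exact hinj l l' a a.ne_zero ha.symm
  have : Fintype (Projectivization F (Fin 4 → F)) := Fintype.ofFinite _
  -- Lines are as many as the points of PG(3,q), so every vector of the separating family comes from
  -- a line.
  have hfs : Function.Surjective f := by
    refine ((Fintype.bijective_iff_injective_and_card f).mpr ⟨hf, ?_⟩).2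
    rw [hB.card_lines, ← Nat.card_eq_fintype_card, card_of_finrank F (n := 4) _ (by simp)]
    simp only [Finset.sum_range_succ, Finset.sum_range_zero]
    ring
  obtain ⟨a, ha0, -, ha⟩ := exists_separating_family (Pi.basisFun F (Fin 4))
  choose g hg using fun s : Fin 4 × F => hfs (Projectivization.mk F (a s.1 s.2) (ha0 _ _))
  have : Fintype F := Fintype.ofFinite F
  refine ⟨univ.image g, card_image_le.trans (by simp), ?_⟩
  intro l l' h _
  obtain ⟨r, hr, he⟩ := ha (pluckerForm F (δ l)) (pluckerForm F (δ l')) fun i t => by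
    have h1 := (h (g (i, t)) (mem_image_of_mem _ (mem_univ _))).2
    obtain ⟨c, hc⟩ := (mk_eq_mk_iff F _ _ (hδ0 _) (ha0 i t)).mp (hg (i, t))
    rw [hδ, hδ, ← hc] at h1
    simpa [Units.smul_def] using h1
  rw [← map_smul] at he
  exact hinj l l' r hr (pluckerForm_injective he)

theorem exists_resolving_lines_of_two_ne_zero (hB : IsSymplectic B) (hF : (2 : F) ≠ 0) {u v : V}
    (h : LinearIndependent F ![u, v]) (huv : B u v = 0) {A : Finset (Projectivization F V)}
    (hA : ∀ (t : F) (ht : t • u + v ≠ 0), Projectivization.mk F (t • u + v) ht ∈ A) :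
    ∃ C : Finset (Line B), #C + 1 ≤ 4 * Nat.card F ∧
      ResolvesPoints (fun l p => Inc B p l) C A := by
  obtain ⟨m, hm⟩ := hB.exists_line_of_apply_eq_zero h huv
  have hu : u ∈ m.1 := by rw [hm]; exact Submodule.subset_span (by simp)
  have hv : v ∈ m.1 := by rw [hm]; exact Submodule.subset_span (by simp)
  have hpair := LinearIndependent.pair_iff.mp h
  have hu0 : u ≠ 0 := h.ne_zero 0
  have hv0 : v ≠ 0 := h.ne_zero 1
  have huv0 : u + v ≠ 0 := fun h0 => one_ne_zero (hpair 1 1 (by simpa using h0)).1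
  have h12 : Projectivization.mk F u hu0 ≠ Projectivization.mk F v hv0 := by
    rw [Ne, mk_eq_mk_iff']
    rintro ⟨a, ha⟩
    simpa using (hpair 1 (-a) (by rw [← ha]; module)).1
  have h13 : Projectivization.mk F u hu0 ≠ Projectivization.mk F (u + v) huv0 := by
    rw [Ne, mk_eq_mk_iff']
    rintro ⟨a, ha⟩
    obtain ⟨e1, e2⟩ := hpair (1 - a) (-a) (by
      rw [show (1 - a) • u + (-a) • v = u - a • (u + v) by module, ha, sub_self])
    rw [neg_eq_zero.mp e2] at e1
    simp at e1
  have h23 : Projectivization.mk F v hv0 ≠ Projectivization.mk F (u + v) huv0 := by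
    rw [Ne, mk_eq_mk_iff']
    rintro ⟨a, ha⟩
    obtain ⟨e1, e2⟩ := hpair (-a) (1 - a) (by
      rw [show (-a) • u + (1 - a) • v = v - a • (u + v) by module, ha, sub_self])
    rw [neg_eq_zero.mp e1] at e2
    simp at e2
  have h1 : Inc B (Projectivization.mk F u hu0) m := inc_mk.mpr hu
  have h2 : Inc B (Projectivization.mk F v hv0) m := inc_mk.mpr hv
  have h3 : Inc B (Projectivization.mk F (u + v) huv0) m := inc_mk.mpr (m.1.add_mem hu hv)
  refine hB.isGQ.exists_resolving_lines Nat.card_pos card_points_on_line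
    hB.card_lines_on_point h1 h2 h3 h12 h13 h23 ?_ ?_
  · intro l l' hne hl hl' m₁ m₂ m₃ hm1 hm2 hm3 hk
    refine hB.false_of_three_transversals hF h1 h2 h3 h12 h13 h23 hl hl' ?_ hm1 hm2 hm3 hk
    intro p hpl hpl'
    have hmem : ∀ k ∈ [m₁, m₂, m₃], Inc B p k := by
      intro k hkm
      by_contra hpk
      obtain ⟨⟨x, hx, hxk⟩, ⟨x', hx', hxk'⟩⟩ := hk k hkm
      exact hne (hB.isGQ.proj_unique p k hpk x l x' l' hpl hx hxk hpl' hx' hxk').2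
    exact h12 (hB.isGQ.proj_unique p m (fun hpm => hl p hpm hpl) _ m₁ _ m₂ (hmem m₁ (by simp))
      hm1 h1 (hmem m₂ (by simp)) hm2 h2).1
  · intro p hpm hp
    rw [inc_iff, hm] at hpm
    obtain ⟨s, t, hst⟩ := Submodule.mem_span_pair.mp hpm
    have ht : t ≠ 0 := by
      rintro rfl
      refine hp ?_
      rw [← mk_rep p, mk_eq_mk_iff']
      exact ⟨s, by rw [← hst]; module⟩
    have hw : (t⁻¹ * s) • u + v = t⁻¹ • p.rep := by
      rw [← hst, smul_add, smul_smul, smul_smul, inv_mul_cancel₀ ht, one_smul]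
    have hw0 : (t⁻¹ * s) • u + v ≠ 0 := by
      rw [hw]
      exact smul_ne_zero (inv_ne_zero ht) p.rep_nonzero
    have hpe : p = Projectivization.mk F _ hw0 := by
      conv_lhs => rw [← mk_rep p]
      rw [mk_eq_mk_iff']
      exact ⟨t, by rw [hw, smul_smul, mul_inv_cancel₀ ht, one_smul]⟩
    rw [hpe]
    exact hA _ hw0

/-- Small resolving sets for the symplectic quadrangle. -/
theorem exists_isResolvingSet (hB : IsSymplectic B) : ∃ S : Finset (Projectivization F V ⊕ Line B),
    (graph B).IsResolvingSet S ∧ #S ≤ 8 * Nat.card F ∧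
      (Odd (Nat.card F) → #S + 1 ≤ 8 * Nat.card F) := by
  -- The span of b 0 and b 1 is isotropic, so the first q points of the family are a line m of the
  -- quadrangle minus the point b 0. This is the configuration needed in odd characteristic, with b
  -- 0 as a₁.
  obtain ⟨b, h01, -⟩ := hB.exists_basis
  obtain ⟨a, ha0, hab, ha⟩ := exists_separating_family b
  have : Fintype F := Fintype.ofFinite F
  let A : Finset (Projectivization F V) :=
    univ.image fun s : Fin 4 × F => Projectivization.mk F (a s.1 s.2) (ha0 _ _)
  have hAcard : #A ≤ 4 * Nat.card F := card_image_le.trans (by simp)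
  have hAmem : ∀ i t, Projectivization.mk F (a i t) (ha0 i t) ∈ A := fun i t =>
    mem_image_of_mem (fun s : Fin 4 × F => Projectivization.mk F (a s.1 s.2) (ha0 _ _))
      (mem_univ (i, t))
  have hne : Nonempty (Projectivization F V) := ⟨Projectivization.mk F (a 0 0) (ha0 0 0)⟩
  have hpts := hB.resolvesPoints_of_separating (a := fun s : Fin 4 × F => a s.1 s.2)
    (fun _ => ha0 _ _) (fun φ ψ h => ha φ ψ fun i t => h (i, t)) (A := A)
    (fun s => hAmem s.1 s.2)
  have hres : ∀ C, ResolvesPoints (fun l p => Inc B p l) C A →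
      (graph B).IsResolvingSet (A.disjSum C) := fun C hC =>
    hB.isGQ.isResolvingSet_disjSum ⟨_, hAmem 0 0⟩ (hpts C) hC
  by_cases hF : (2 : F) = 0
  · obtain ⟨C, hC, hC'⟩ := hB.exists_resolving_lines_of_two_eq_zero hF A
    refine ⟨A.disjSum C, hres C hC', ?_, fun hodd => ?_⟩
    · rw [card_disjSum]
      omega
    · have h2 : ringChar F = 2 := CharP.ringChar_of_prime_eq_zero Nat.prime_two (by exact_mod_cast hF)
      have := FiniteField.even_card_of_char_two h2
      rw [Nat.card_eq_fintype_card, Nat.odd_iff] at hodd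
      omega
  · have hli : LinearIndependent F ![b 0, b 1] := by
      rw [LinearIndependent.pair_iff]
      intro s t hst
      exact ⟨by simpa using congrArg (fun v => b.repr v 0) hst,
        by simpa using congrArg (fun v => b.repr v 1) hst⟩
    obtain ⟨C, hC, hC'⟩ := hB.exists_resolving_lines_of_two_ne_zero hF hli h01 (A := A) (by
      intro t
      rw [← hab t]
      exact fun _ => hAmem 0 t)
    have hcard : #(A.disjSum C) + 1 ≤ 8 * Nat.card F := by
      rw [card_disjSum]
      omega
    exact ⟨A.disjSum C, hres C hC', by omega, fun _ => hcard⟩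

end IsSymplectic

end SymplecticQuadrangle

theorem mainTheorem9 {F V : Type*} [Field F] [Finite F] [AddCommGroup V] [Module F V]
    (hV : Module.finrank F V = 4) (B : LinearMap.BilinForm F V)
    (hBalt : B.IsAlt) (hB : B.Nondegenerate) (q : ℕ) (hq : Nat.card F = q) :
    max (6 * (q : ℤ) - 27) (4 * (q : ℤ) - 7) ≤
        ((SymplecticQuadrangle.graph B).metricDimension : ℤ) ∧
      ((SymplecticQuadrangle.graph B).metricDimension : ℤ) ≤ 8 * (q : ℤ) ∧
      (Odd q → ((SymplecticQuadrangle.graph B).metricDimension : ℤ) ≤ 8 * (q : ℤ) - 1) := by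
  subst hq
  have hW : SymplecticQuadrangle.IsSymplectic B := ⟨hV, hBalt, hB⟩
  have := hW.finite_points
  have := hW.finite_lines
  have : Fintype (Projectivization F V) := Fintype.ofFinite _
  have : Fintype (SymplecticQuadrangle.Line B) := Fintype.ofFinite _
  obtain ⟨S, hS, h8, hodd⟩ := hW.exists_isResolvingSet
  have hle : (SymplecticQuadrangle.graph B).metricDimension ≤ S.card := Nat.sInf_le ⟨S, hS, rfl⟩
  -- The set of sizes is nonempty, so the infimum is attained rather than being the default value 0.
  obtain ⟨T, hT, hTcard⟩ : ∃ T, (SymplecticQuadrangle.graph B).IsResolvingSet T ∧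
      T.card = (SymplecticQuadrangle.graph B).metricDimension :=
    Nat.sInf_mem (s := {n | ∃ T : Finset _, (SymplecticQuadrangle.graph B).IsResolvingSet T ∧
      T.card = n}) ⟨S.card, S, hS, rfl⟩
  have hlow := hW.isGQ.le_card_of_isResolvingSet hW.card_points hW.card_lines
    (fun l => (SymplecticQuadrangle.IsSymplectic.card_points_on_line l).le)
    (fun p => (hW.card_lines_on_point p).le) hT
  refine ⟨max_le (by omega) (by omega), by omega, fun h => ?_⟩
  have := hodd h
  omega
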